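/- **Theorem (spectrum of the area operator).** Let $\Lambda\in\mathbb R\setminus\{0\}$, $q=e^{i\theta}$ with $\theta\in(0,2\pi)$, $q^x:=e^{i\theta x}$ for real $x$, and $[x]_q:=\frac{q^x-q^{-x}}{q-q^{-1}}$ (at $q=-1$ quotients with denominator $0$ are read as $0$). Let $\mathcal U_q(\mathfrak{su}(2))$ be generated by $q^{\pm H/2},X,Y$ with $q^{H/2}Xq^{-H/2}=qX$, $q^{H/2}Yq^{-H/2}=q^{-1}Y$, $[X,Y]=\frac{q^H-q^{-H}}{q-q^{-1}}$, with coproduct $\Delta(q^{\pm H/2})=q^{\pm H/2}\otimes q^{\pm H/2}$, $\Delta(Z)=Z\otimes q^{H/2}+q^{-H/2}\otimes Z$ for $Z=X,Y$, and with $R$-matrix $$R=\sum_{n\ge 0}\frac{(q-q^{-1})^n}{[n]_q!}\,q^{-n(n+1)/2}\,q^{\frac12 H\otimes H+\frac n2(H\otimes 1-1\otimes H)}\,(X^n\otimes Y^n),\qquad R'=\sigma(R),$$ $\sigma$ being the flip of the tensor factors. For $J\in\frac12\mathbb N$ let $\rho^J$ be the spin-$J$ representation on $V^J$ with basis $(e_m)_{m=-J}^{J}$,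 $q^{H/2}e_m=q^me_m$, $Xe_m=\sqrt{[J-m]_q[J+m+1]_q}\,e_{m+1}$, $Ye_m=\sqrt{[J+m]_q[J-m+1]_q}\,e_{m-1}$; let $\mathrm{tr}_q^J(Z)=\mathrm{tr}(Z\rho^J(q^{-H}))$ be the quantum trace, $d_J=\mathrm{tr}_q^J(1)$, and $\kappa_J=q^{-J(J+1)}$. The quantum holonomy $M^J$ around a puncture is represented on $V^K$ by $D^K(M^J)=\kappa_J^{-1}(\rho^J\otimes\rho^K)(R'R)$, and its central element $c^J=\kappa_J\,\mathrm{tr}_q^J(M^J)$ by $D^K(c^J)=(\mathrm{tr}_q^J\otimes\mathrm{id})\big((\rho^J\otimes\rho^K)(R'R)\big)\in\mathrm{End}(V^K)$. The area spectrum $\mathrm{spec}^K(\hat a)$ on spin $K$ consists of the real $a$ with $\frac{|\Lambda|}{6}a\in[0,\pi]$ for which $\cos\big(\frac{|\Lambda|}{6}a\big)$ is in the spectrum of $\frac12D^K(c^{1/2})$. (1) For every $K\in\frac12\mathbb N$, $D^K(c^{1/2})=2\cos((2K+1)\theta)\,\mathrm{Id}$. If $[2K+1]_q\neq0$, then $d_K=[2K+1]_q$,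 $(\mathrm{tr}_q^{1/2}\otimes\mathrm{tr}_q^K)(R'R)=[2(2K+1)]_q$, and $D^K(c^{1/2})=\frac{[2(2K+1)]_q}{[2K+1]_q}\,\mathrm{Id}$. (2) The area spectrum is the single value $$\mathrm{spec}^K(\hat a)=\begin{cases}\frac{6}{|\Lambda|}(2K+1)\theta, & 0\le K<\frac12\left(\frac{\pi}{\theta}-1\right),\\[2pt] \frac{6}{|\Lambda|}\left[2\pi-(2K+1)\theta\right], & \frac12\left(\frac{\pi}{\theta}-1\right)\le K<\frac12\left(\frac{2\pi}{\theta}-1\right).\end{cases}$$ (3) If $q=e^{2\pi i/(k+2)}$ with $k\in\mathbb N$ and $K\le\frac k2$, then $$\mathrm{spec}^K(\hat a)=\begin{cases}\frac{6}{|\Lambda|}(2K+1)\frac{2\pi}{k+2}, & 0\le K<\frac k4,\\[2pt] \frac{6}{|\Lambda|}\left[2\pi-(2K+1)\frac{2\pi}{k+2}\right], & \frac k4\le K\le\frac k2.\end{cases}$$ For $k\ge1$ the same holds for the truncated algebra. That is, let $P$ be a projector of $V^{1/2}\otimes V^K$ onto its physical components: $P=1$ if $K+\frac12\le\frac k2$,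 and if $K=\frac k2$ then $P=EC$ for intertwiners $E:V^{K-1/2}\to V^{1/2}\otimes V^K$ and $C:V^{1/2}\otimes V^K\to V^{K-1/2}$ with $CE=1$. Such a $P$ exists, and for every such $P$, when $R'R$ is replaced by $R'R\,P$, one still has $D^K(c^{1/2})=2\cos((2K+1)\theta)\,\mathrm{Id}$ and $(\mathrm{tr}_q^{1/2}\otimes\mathrm{tr}_q^K)(R'R\,P)=[2(2K+1)]_q$ with $\theta=\frac{2\pi}{k+2}$, and the area spectrum is given by the same formula. -/

import Mathlib

open scoped Matrix Kronecker TensorProduct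

noncomputable section

/-! ### Powers of `q = exp (i θ)` and `q`-numbers -/

/-- `q ^ x = exp (i θ x)` for `q = exp (i θ)` and a real exponent `x`. -/
def qpow (θ x : ℝ) : ℂ := Complex.exp (Complex.I * ((θ * x : ℝ) : ℂ))

/-- The `q`-number `[x] = (q ^ x - q ^ (-x)) / (q - q⁻¹)`. -/
def qnum (θ x : ℝ) : ℂ := (qpow θ x - qpow θ (-x)) / (qpow θ 1 - qpow θ (-1))

/-- `[j]! = [1] [2] ⋯ [j]`. -/
def qfact (θ : ℝ) (j : ℕ) : ℂ := ∏ i ∈ Finset.range j, qnum θ ((i : ℝ) + 1)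

/-- A complex square root (principal branch). -/
def csqrt (z : ℂ) : ℂ := z ^ (1 / 2 : ℂ)

lemma csqrt_mul_self (z : ℂ) : csqrt z * csqrt z = z := by
  have h : csqrt z ^ 2 = z := by
    unfold csqrt
    simp
  rw [← sq, h]

lemma qpow_add (θ x y : ℝ) : qpow θ (x + y) = qpow θ x * qpow θ y := by
  unfold qpow
  rw [← Complex.exp_add]
  congr 1
  push_cast
  ring

lemma qpow_zero (θ : ℝ) : qpow θ 0 = 1 := by simp [qpow]

lemma qnum_zero (θ : ℝ) : qnum θ 0 = 0 := by simp [qnum]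

/-! ### The algebra `U_q(su(2))` -/

/-- Generators: `k = q ^ (H / 2)`, its inverse, `X` and `Y`. -/
inductive UqGen
  | k
  | kinv
  | X
  | Y

/-- The free generators. -/
abbrev ug (g : UqGen) : FreeAlgebra ℂ UqGen := FreeAlgebra.ι ℂ g

/-- Defining relations of `U_q(su(2))`. -/
inductive UqRel (θ : ℝ) : FreeAlgebra ℂ UqGen → FreeAlgebra ℂ UqGen → Prop
  | k_kinv : UqRel θ (ug .k * ug .kinv) 1
  | kinv_k : UqRel θ (ug .kinv * ug .k) 1
  | k_X : UqRel θ (ug .k * ug .X) (qpow θ 1 • (ug .X * ug .k))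
  | k_Y : UqRel θ (ug .k * ug .Y) (qpow θ (-1) • (ug .Y * ug .k))
  | X_Y : UqRel θ (ug .X * ug .Y - ug .Y * ug .X)
      ((qpow θ 1 - qpow θ (-1))⁻¹ • (ug .k * ug .k - ug .kinv * ug .kinv))

/-- `U_q(su(2))` at `q = exp (i θ)`, as an associative unital complex algebra. -/
abbrev Uq (θ : ℝ) : Type := RingQuot (UqRel θ)

/-- The generators of `U_q(su(2))`. -/
def uq (θ : ℝ) (g : UqGen) : Uq θ := RingQuot.mkAlgHom ℂ (UqRel θ) (ug g)

/-- The universal property: an algebra map is determined by images of the generators that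
satisfy the relations. -/
def Uq.lift (θ : ℝ) {A : Type} [Ring A] [Algebra ℂ A] (f : UqGen → A)
    (h1 : f .k * f .kinv = 1) (h2 : f .kinv * f .k = 1)
    (h3 : f .k * f .X = qpow θ 1 • (f .X * f .k))
    (h4 : f .k * f .Y = qpow θ (-1) • (f .Y * f .k))
    (h5 : f .X * f .Y - f .Y * f .X =
      (qpow θ 1 - qpow θ (-1))⁻¹ • (f .k * f .k - f .kinv * f .kinv)) : Uq θ →ₐ[ℂ] A :=
  RingQuot.liftAlgHom ℂ ⟨FreeAlgebra.lift ℂ f, by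
    intro x y h
    cases h <;> simpa using by assumption⟩

lemma Uq.lift_uq (θ : ℝ) {A : Type} [Ring A] [Algebra ℂ A] (f : UqGen → A)
    (h1 h2 h3 h4 h5) (g : UqGen) : Uq.lift θ f h1 h2 h3 h4 h5 (uq θ g) = f g := by
  simp [Uq.lift, uq, RingQuot.liftAlgHom_mkAlgHom_apply]

lemma uq_k_kinv (θ : ℝ) : uq θ .k * uq θ .kinv = 1 := by
  simpa [uq] using RingQuot.mkAlgHom_rel ℂ (UqRel.k_kinv (θ := θ))

lemma uq_kinv_k (θ : ℝ) : uq θ .kinv * uq θ .k = 1 := by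
  simpa [uq] using RingQuot.mkAlgHom_rel ℂ (UqRel.kinv_k (θ := θ))

lemma uq_k_X (θ : ℝ) : uq θ .k * uq θ .X = qpow θ 1 • (uq θ .X * uq θ .k) := by
  simpa [uq] using RingQuot.mkAlgHom_rel ℂ (UqRel.k_X (θ := θ))

lemma uq_k_Y (θ : ℝ) : uq θ .k * uq θ .Y = qpow θ (-1) • (uq θ .Y * uq θ .k) := by
  simpa [uq] using RingQuot.mkAlgHom_rel ℂ (UqRel.k_Y (θ := θ))

lemma uq_X_Y (θ : ℝ) : uq θ .X * uq θ .Y - uq θ .Y * uq θ .X =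
    (qpow θ 1 - qpow θ (-1))⁻¹ • (uq θ .k * uq θ .k - uq θ .kinv * uq θ .kinv) := by
  simpa [uq] using RingQuot.mkAlgHom_rel ℂ (UqRel.X_Y (θ := θ))

/-- Values of the coproduct on the generators. -/
def coprodGen (θ : ℝ) : UqGen → Uq θ ⊗[ℂ] Uq θ
  | .k => uq θ .k ⊗ₜ uq θ .k
  | .kinv => uq θ .kinv ⊗ₜ uq θ .kinv
  | .X => uq θ .X ⊗ₜ uq θ .k + uq θ .kinv ⊗ₜ uq θ .X
  | .Y => uq θ .Y ⊗ₜ uq θ .k + uq θ .kinv ⊗ₜ uq θ .Y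

lemma qpow_mul_neg (θ x : ℝ) : qpow θ x * qpow θ (-x) = 1 := by
  rw [← qpow_add, add_neg_cancel, qpow_zero]

lemma uq_kinv_X (θ : ℝ) : uq θ .kinv * uq θ .X = qpow θ (-1) • (uq θ .X * uq θ .kinv) := by
  have h : uq θ .kinv * (uq θ .k * uq θ .X) * uq θ .kinv = uq θ .X * uq θ .kinv := by
    rw [← mul_assoc, uq_kinv_k, one_mul]
  rw [← h, uq_k_X, mul_smul_comm, smul_mul_assoc, smul_smul, mul_comm (qpow θ (-1)),
    qpow_mul_neg, one_smul, mul_assoc, mul_assoc, uq_k_kinv, mul_one]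

lemma uq_kinv_Y (θ : ℝ) : uq θ .kinv * uq θ .Y = qpow θ 1 • (uq θ .Y * uq θ .kinv) := by
  have h : uq θ .kinv * (uq θ .k * uq θ .Y) * uq θ .kinv = uq θ .Y * uq θ .kinv := by
    rw [← mul_assoc, uq_kinv_k, one_mul]
  rw [← h, uq_k_Y, mul_smul_comm, smul_mul_assoc, smul_smul,
    qpow_mul_neg, one_smul, mul_assoc, mul_assoc, uq_k_kinv, mul_one]

lemma coprodGen_X_Y (θ : ℝ) :
    coprodGen θ .X * coprodGen θ .Y - coprodGen θ .Y * coprodGen θ .X =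
      (qpow θ 1 - qpow θ (-1))⁻¹ •
        (coprodGen θ .k * coprodGen θ .k - coprodGen θ .kinv * coprodGen θ .kinv) := by
  have hXY : uq θ .X * uq θ .Y = uq θ .Y * uq θ .X +
      (qpow θ 1 - qpow θ (-1))⁻¹ • (uq θ .k * uq θ .k - uq θ .kinv * uq θ .kinv) := by
    rw [← uq_X_Y]; abel
  simp only [coprodGen, mul_add, add_mul, Algebra.TensorProduct.tmul_mul_tmul, uq_k_X, uq_k_Y,
    uq_kinv_X, uq_kinv_Y, hXY, TensorProduct.add_tmul, TensorProduct.tmul_add,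
    TensorProduct.smul_tmul', TensorProduct.tmul_smul, TensorProduct.sub_tmul,
    TensorProduct.tmul_sub, smul_sub]
  abel

/-- The coproduct `Δ`. -/
def coprod (θ : ℝ) : Uq θ →ₐ[ℂ] Uq θ ⊗[ℂ] Uq θ :=
  Uq.lift θ (coprodGen θ)
    (by simp [coprodGen, uq_k_kinv]; rfl)
    (by simp [coprodGen, uq_kinv_k]; rfl)
    (by
      simp only [coprodGen, mul_add, add_mul, Algebra.TensorProduct.tmul_mul_tmul, uq_k_X,
        uq_k_kinv, uq_kinv_k, TensorProduct.smul_tmul', TensorProduct.tmul_smul, smul_add])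
    (by
      simp only [coprodGen, mul_add, add_mul, Algebra.TensorProduct.tmul_mul_tmul, uq_k_Y,
        uq_k_kinv, uq_kinv_k, TensorProduct.smul_tmul', TensorProduct.tmul_smul, smul_add])
    (coprodGen_X_Y θ)

/-! ### The spin-`n/2` representations. Spins are recorded by the natural number `n = 2 J`. -/

/-- The magnetic number `m = i - J ∈ {-J, …, J}` of the `i`-th basis vector, `J = n / 2`. -/
def wt (n : ℕ) (i : Fin (n + 1)) : ℝ := (i : ℝ) - n / 2

/-- Matrices of the generators in the basis `e_m` of `V^J`, `J = n / 2`: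
`q^{H/2} e_m = q^m e_m`, `X e_m = √([J-m][J+m+1]) e_{m+1}`, `Y e_m = √([J+m][J-m+1]) e_{m-1}`. -/
def rhoGen (θ : ℝ) (n : ℕ) : UqGen → Matrix (Fin (n + 1)) (Fin (n + 1)) ℂ
  | .k => Matrix.diagonal fun i => qpow θ (wt n i)
  | .kinv => Matrix.diagonal fun i => qpow θ (-wt n i)
  | .X => Matrix.of fun a b => if (a : ℕ) = b + 1 then
      csqrt (qnum θ (n / 2 - wt n b) * qnum θ (n / 2 + wt n b + 1)) else 0
  | .Y => Matrix.of fun a b => if (b : ℕ) = a + 1 then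
      csqrt (qnum θ (n / 2 + wt n b) * qnum θ (n / 2 - wt n b + 1)) else 0

lemma rhoGen_X_Y_apply (θ : ℝ) (n : ℕ) (a b : Fin (n + 1)) :
    (rhoGen θ n .X * rhoGen θ n .Y) a b =
      if a = b then qnum θ (n / 2 + wt n a) * qnum θ (n / 2 - wt n a + 1) else 0 := by
  rw [Matrix.mul_apply]
  by_cases ha : (a : ℕ) = 0
  · rw [Finset.sum_eq_zero]
    · have : (n / 2 + wt n a : ℝ) = 0 := by simp [wt, ha]
      simp [this, qnum_zero]
    · intro c _
      simp [rhoGen, ha]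
  · obtain ⟨c, hc⟩ : ∃ c : Fin (n + 1), (a : ℕ) = c + 1 := ⟨⟨a - 1, by omega⟩, by simp; omega⟩
    rw [Finset.sum_eq_single c]
    · by_cases hab : a = b
      · subst hab
        have h1 : (n / 2 - wt n c : ℝ) = n / 2 - wt n a + 1 := by simp [wt, hc]; ring
        have h2 : (n / 2 + wt n c + 1 : ℝ) = n / 2 + wt n a := by simp [wt, hc]
        simp only [rhoGen, Matrix.of_apply, hc, if_true, h1, h2]
        rw [mul_comm (qnum θ (n / 2 - wt n a + 1)), csqrt_mul_self]
      · have : ¬ ((b : ℕ) = c + 1) := fun h => hab (Fin.ext (by omega))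
        simp [rhoGen, this, hab]
    · intro d _ hd
      have : ¬ ((a : ℕ) = d + 1) := fun h => hd (Fin.ext (by omega))
      simp [rhoGen, this]
    · simp

lemma rhoGen_Y_X_apply (θ : ℝ) (n : ℕ) (a b : Fin (n + 1)) :
    (rhoGen θ n .Y * rhoGen θ n .X) a b =
      if a = b then qnum θ (n / 2 - wt n a) * qnum θ (n / 2 + wt n a + 1) else 0 := by
  rw [Matrix.mul_apply]
  by_cases ha : (a : ℕ) = n
  · rw [Finset.sum_eq_zero]
    · have : (n / 2 - wt n a : ℝ) = 0 := by simp [wt, ha]; ring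
      simp [this, qnum_zero]
    · intro c _
      have : ¬ ((c : ℕ) = a + 1) := by omega
      simp [rhoGen, this]
  · obtain ⟨c, hc⟩ : ∃ c : Fin (n + 1), (c : ℕ) = a + 1 := ⟨⟨a + 1, by omega⟩, rfl⟩
    rw [Finset.sum_eq_single c]
    · by_cases hab : a = b
      · subst hab
        have h1 : (n / 2 + wt n c : ℝ) = n / 2 + wt n a + 1 := by simp [wt, hc]
        have h2 : (n / 2 - wt n c + 1 : ℝ) = n / 2 - wt n a := by simp [wt, hc]; ring
        simp only [rhoGen, Matrix.of_apply, hc, if_true, h1, h2]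
        rw [mul_comm (qnum θ (n / 2 + wt n a + 1)), csqrt_mul_self]
      · have : ¬ ((c : ℕ) = b + 1) := fun h => hab (Fin.ext (by omega))
        simp [rhoGen, this, hab]
    · intro d _ hd
      have : ¬ ((d : ℕ) = a + 1) := fun h => hd (Fin.ext (by omega))
      simp [rhoGen, this]
    · simp

lemma qnum_identity (θ x m : ℝ) :
    qnum θ (x + m) * qnum θ (x - m + 1) - qnum θ (x - m) * qnum θ (x + m + 1) =
      (qpow θ 1 - qpow θ (-1))⁻¹ * (qpow θ m * qpow θ m - qpow θ (-m) * qpow θ (-m)) := by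
  have e : ∀ y, qpow θ (-y) = (qpow θ y)⁻¹ := fun y =>
    (eq_inv_of_mul_eq_one_right (qpow_mul_neg θ y))
  have hne : ∀ y, qpow θ y ≠ 0 := fun y => Complex.exp_ne_zero _
  by_cases hq : qpow θ 1 - qpow θ (-1) = 0
  · simp [qnum, hq]
  · unfold qnum
    rw [show -(x + m) = -x + -m by ring, show -(x - m + 1) = -x + m + -1 by ring,
      show -(x - m) = -x + m by ring, show -(x + m + 1) = -x + -m + -1 by ring,
      show x - m = x + -m by ring]
    simp only [qpow_add, e] at hq ⊢
    have h1 := hne 1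
    have h2 := hne x
    have h3 := hne m
    generalize qpow θ 1 = Q at *
    generalize qpow θ x = A at *
    generalize qpow θ m = B at *
    have h4 : Q ^ 2 - 1 ≠ 0 := by
      intro h
      apply hq
      field_simp
      simpa using h
    field_simp
    ring

/-- The representation `ρ^J` of `U_q(su(2))` on `V^J`, `J = n / 2`. -/
def rho (θ : ℝ) (n : ℕ) : Uq θ →ₐ[ℂ] Matrix (Fin (n + 1)) (Fin (n + 1)) ℂ :=
  Uq.lift θ (rhoGen θ n)
    (by simp [rhoGen, qpow_mul_neg])
    (by simp [rhoGen, mul_comm (qpow θ (-_)), qpow_mul_neg])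
    (by
      ext a b
      simp only [rhoGen, Matrix.diagonal_mul, Matrix.smul_apply, Matrix.mul_diagonal,
        Matrix.of_apply, smul_eq_mul]
      split_ifs with h
      · have : wt n a = 1 + wt n b := by simp [wt, h]; ring
        rw [this, qpow_add]; ring
      · simp)
    (by
      ext a b
      simp only [rhoGen, Matrix.diagonal_mul, Matrix.smul_apply, Matrix.mul_diagonal,
        Matrix.of_apply, smul_eq_mul]
      split_ifs with h
      · have : wt n a = -1 + wt n b := by simp [wt, h]; ring
        rw [this, qpow_add]; ring
      · simp)
    (by
      ext a b
      rw [Matrix.sub_apply, rhoGen_X_Y_apply, rhoGen_Y_X_apply]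
      by_cases h : a = b
      · subst h
        simp [rhoGen, qnum_identity]
      · simp [rhoGen, h])

/-- `ρ^I ⊗ ρ^J` on `U_q ⊗ U_q`, with values in `End (V^I ⊗ V^J)`; `I = a / 2`, `J = b / 2`. -/
def rhoTensor (θ : ℝ) (a b : ℕ) : Uq θ ⊗[ℂ] Uq θ →ₐ[ℂ]
    Matrix (Fin (a + 1) × Fin (b + 1)) (Fin (a + 1) × Fin (b + 1)) ℂ :=
  (Matrix.kroneckerAlgEquiv (Fin (a + 1)) (Fin (b + 1)) ℂ).toAlgHom.comp
    (Algebra.TensorProduct.map (rho θ a) (rho θ b))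

/-- The tensor product representation `ρ^I ⊠ ρ^J = (ρ^I ⊗ ρ^J) ∘ Δ`. -/
def rhoBox (θ : ℝ) (a b : ℕ) : Uq θ →ₐ[ℂ]
    Matrix (Fin (a + 1) × Fin (b + 1)) (Fin (a + 1) × Fin (b + 1)) ℂ :=
  (rhoTensor θ a b).comp (coprod θ)

/-! ### The `R`-matrix and the quantum trace -/

/-- `R^{IJ} = (ρ^I ⊗ ρ^J)(R)` for
`R = ∑ⱼ (q - q⁻¹)^j / [j]! · q^{-j(j+1)/2} · q^{(H ⊗ H)/2 + (j/2)(H ⊗ 1 - 1 ⊗ H)} (X^j ⊗ Y^j)`.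
On `e_m ⊗ e_{m'}` the operator `H ⊗ 1` is `2 m` and `1 ⊗ H` is `2 m'`; the terms with `j > 2 I`
vanish because `ρ^I(X)^(2 I + 1) = 0`. -/
def Rmat (θ : ℝ) (a b : ℕ) :
    Matrix (Fin (a + 1) × Fin (b + 1)) (Fin (a + 1) × Fin (b + 1)) ℂ :=
  ∑ j ∈ Finset.range (a + 1),
    ((qpow θ 1 - qpow θ (-1)) ^ j / qfact θ j * qpow θ (-((j : ℝ) * (j + 1) / 2))) •
      (Matrix.diagonal (fun p : Fin (a + 1) × Fin (b + 1) =>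
          qpow θ (2 * wt a p.1 * wt b p.2 + j * (wt a p.1 - wt b p.2))) *
        ((rho θ a (uq θ .X) ^ j) ⊗ₖ (rho θ b (uq θ .Y) ^ j)))

/-- `(R')^{IJ} = (ρ^I ⊗ ρ^J)(σ(R))`, where `σ` flips the two tensor factors. -/
def RmatFlip (θ : ℝ) (a b : ℕ) :
    Matrix (Fin (a + 1) × Fin (b + 1)) (Fin (a + 1) × Fin (b + 1)) ℂ :=
  (Rmat θ b a).submatrix Prod.swap Prod.swap

/-- The monodromy `(R'R)^{IJ}`. -/
def RR (θ : ℝ) (a b : ℕ) :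
    Matrix (Fin (a + 1) × Fin (b + 1)) (Fin (a + 1) × Fin (b + 1)) ℂ :=
  RmatFlip θ a b * Rmat θ a b

/-- The group-like element `g = q^{-H}` that defines the quantum trace. -/
def grouplike (θ : ℝ) : Uq θ := uq θ .kinv * uq θ .kinv

/-- The quantum trace `tr_q^J(Z) = tr(Z ρ^J(g))` on `End (V^J)`. -/
def qtr (θ : ℝ) (n : ℕ) (Z : Matrix (Fin (n + 1)) (Fin (n + 1)) ℂ) : ℂ :=
  (Z * rho θ n (grouplike θ)).trace

/-- The quantum dimension `d_J = tr_q^J(1)`. -/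
def qdim (θ : ℝ) (n : ℕ) : ℂ := qtr θ n 1

/-- The partial quantum trace `tr_q^I ⊗ id : End (V^I ⊗ V^J) → End (V^J)`. -/
def qtrLeft (θ : ℝ) (a b : ℕ)
    (Z : Matrix (Fin (a + 1) × Fin (b + 1)) (Fin (a + 1) × Fin (b + 1)) ℂ) :
    Matrix (Fin (b + 1)) (Fin (b + 1)) ℂ :=
  Matrix.of fun c d => qtr θ a (Matrix.of fun i j => Z (i, c) (j, d))

/-! ### The quantum holonomy, its central element, and the area spectrum -/

/-- `κ_J = q^{-J(J+1)}`, `J = n / 2`. -/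
def kap (θ : ℝ) (n : ℕ) : ℂ := qpow θ (-((n / 2 : ℝ) * (n / 2 + 1)))

/-- The representation `D^K(M^J) = κ_J⁻¹ (R'R)^{JK} ∈ End (V^J) ⊗ End (V^K)` of the quantum
holonomy `M^J` around a puncture; `J = a / 2`, `K = n / 2`. -/
def holonomyRep (θ : ℝ) (a n : ℕ) :
    Matrix (Fin (a + 1) × Fin (n + 1)) (Fin (a + 1) × Fin (n + 1)) ℂ :=
  (kap θ a)⁻¹ • RR θ a n

/-- `D^K(c^J)` for the central element `c^J = κ_J tr_q^J(M^J)`, an operator on `V^K`. -/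
def centralRep (θ : ℝ) (a n : ℕ) : Matrix (Fin (n + 1)) (Fin (n + 1)) ℂ :=
  kap θ a • qtrLeft θ a n (holonomyRep θ a n)

/-- `s_{JK} = (tr_q^J ⊗ tr_q^K)(R'R)`. -/
def sMat (θ : ℝ) (a n : ℕ) : ℂ := qtr θ n (qtrLeft θ a n (RR θ a n))

/-- The area spectrum attached to the operator `D = D^K(c^{1/2})`: the numbers `x` with
`|Λ| x / 6 ∈ [0, π]` for which `cos(|Λ| x / 6)` is in the spectrum of `D / 2`. -/
def areaSpec (Λ : ℝ) {n : ℕ} (D : Matrix (Fin (n + 1)) (Fin (n + 1)) ℂ) : Set ℝ :=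
  {x | |Λ| / 6 * x ∈ Set.Icc 0 Real.pi ∧
    ((Real.cos (|Λ| / 6 * x) : ℝ) : ℂ) ∈ spectrum ℂ ((1 / 2 : ℂ) • D)}

/-! ### Truncation at `q = exp (2 π i / (k + 2))` -/

/-- The (doubled) spins `c = 2 L` of the physical components of `V^I ⊗ V^J`, `a = 2 I`, `b = 2 J`:
`|I - J| ≤ L ≤ min (I + J) (k - I - J)` and `I + J + L` is an integer. -/
def admissible (k a b : ℕ) : Finset ℕ :=
  (Finset.range (a + b + 1)).filter fun c =>
    a ≤ b + c ∧ b ≤ a + c ∧ a + b + c ≤ 2 * k ∧ Even (a + b + c)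

/-- `P` is the projector of `V^I ⊗ V^J` onto its physical components. If `I + J ≤ k / 2`, no
component is cut off and `P = 1`. Otherwise the physical components are given by intertwiners
`E_L : V^L → V^I ⊗ V^J` and `C_L : V^I ⊗ V^J → V^L` with `C_L E_{L'} = δ_{L L'}`, and
`P = ∑_L E_L C_L`. -/
def IsTruncation (θ : ℝ) (k a b : ℕ)
    (P : Matrix (Fin (a + 1) × Fin (b + 1)) (Fin (a + 1) × Fin (b + 1)) ℂ) : Prop :=
  (a + b ≤ k ∧ P = 1) ∨
  (k < a + b ∧
    ∃ (E : (c : ℕ) → Matrix (Fin (a + 1) × Fin (b + 1)) (Fin (c + 1)) ℂ)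
      (C : (c : ℕ) → Matrix (Fin (c + 1)) (Fin (a + 1) × Fin (b + 1)) ℂ),
      (∀ c ∈ admissible k a b, ∀ ξ : Uq θ,
        rhoBox θ a b ξ * E c = E c * rho θ c ξ ∧ C c * rhoBox θ a b ξ = rho θ c ξ * C c) ∧
      (∀ c ∈ admissible k a b, C c * E c = 1) ∧
      (∀ c ∈ admissible k a b, ∀ d ∈ admissible k a b, c ≠ d → C c * E d = 0) ∧
      P = ∑ c ∈ admissible k a b, E c * C c)

/-- `D^K(M^J)` for the truncated algebra: `R'R` is cut down by the projector `P` onto the physical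
components of `V^J ⊗ V^K`. -/
def holonomyRepTrunc (θ : ℝ) (a n : ℕ)
    (P : Matrix (Fin (a + 1) × Fin (n + 1)) (Fin (a + 1) × Fin (n + 1)) ℂ) :
    Matrix (Fin (a + 1) × Fin (n + 1)) (Fin (a + 1) × Fin (n + 1)) ℂ :=
  (kap θ a)⁻¹ • (RR θ a n * P)

/-- `D^K(c^J)` for the truncated algebra. -/
def centralRepTrunc (θ : ℝ) (a n : ℕ)
    (P : Matrix (Fin (a + 1) × Fin (n + 1)) (Fin (a + 1) × Fin (n + 1)) ℂ) :
    Matrix (Fin (n + 1)) (Fin (n + 1)) ℂ :=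
  kap θ a • qtrLeft θ a n (holonomyRepTrunc θ a n P)

/-- `(tr_q^J ⊗ tr_q^K)(R'R P)`. -/
def sMatTrunc (θ : ℝ) (a n : ℕ)
    (P : Matrix (Fin (a + 1) × Fin (n + 1)) (Fin (a + 1) × Fin (n + 1)) ℂ) : ℂ :=
  qtr θ n (qtrLeft θ a n (RR θ a n * P))

end

noncomputable section

/-! ### Powers of `q` and `q`-numbers -/

/-! On `V^{1/2} ⊗ V^K` only the first two terms of the `R`-matrix survive, so `R` and `R'` are
triangular 2×2 matrices with entries in `End V^K`. Their product `R'R` has `k²` in its lower right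
corner (`k = q^{H/2}`). The Casimir relation turns the upper left corner into `q⁻¹ (casVal - q⁻¹
k²)`. In the quantum trace the corners are weighted by `q` and `q⁻¹`, the `k²` terms cancel, and the
scalar `casVal = q^{2K+1} + q^{-(2K+1)} = 2 cos((2K+1)θ)` remains (`RR_one_left`, `qtrLeft_RR`). No
division by `q - q⁻¹` is needed, so `q = -1` is covered. The area spectrum then follows by folding
the angle `(2K+1)θ` into `[0, π]`, where the cosine is injective (`areaSpec_smul_one`).

With truncation only `K = k/2` requires work. Write `n = 2K`. The monodromy satisfies a quadratic
equation with roots `q^n` and `q^{-(n+2)}` (`RR_sq`), belonging to the components of spin `K + 1/2`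
and `K - 1/2`. It is also an affine function of the Casimir of the coproduct (`rhoBox_casimir`), so
every intertwiner from or to `V^{K-1/2}` is an eigenvector for the second root. A trace count then
forces `E C` to be the spectral projector for that root, whatever `E` and `C` are
(`RR_sub_eq_smul_projector`). At `q^{k+2} = 1` this root is 1, hence `R'R P = P`, and the partial
quantum trace of `P` is computed from that of `R'R` (`qtrLeft_RR_mul_of_isTruncation_top`).

The projector exists because explicit Clebsch–Gordan coefficients give an intertwiner `E` with `Eᵀ E
= q⁻¹ [k+1]`, and `[k+1] ≠ 0` at this root of unity (`exists_intertwiner`, `qnum_root_ne_zero`). -/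

lemma qpow_ne_zero (θ x : ℝ) : qpow θ x ≠ 0 := Complex.exp_ne_zero _

lemma qpow_neg (θ x : ℝ) : qpow θ (-x) = (qpow θ x)⁻¹ :=
  eq_inv_of_mul_eq_one_right (qpow_mul_neg θ x)

lemma qpow_one_eq (θ : ℝ) : qpow θ 1 = qpow θ (1 / 2) ^ 2 := by
  rw [sq, ← qpow_add]; norm_num

lemma qpow_add_qpow_neg (θ x : ℝ) :
    qpow θ x + qpow θ (-x) = ((2 * Real.cos (x * θ) : ℝ) : ℂ) := by
  push_cast
  rw [Complex.two_cos]
  unfold qpow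
  congr 2 <;> push_cast <;> ring

lemma qpow_sub_qpow_neg (θ x : ℝ) :
    qpow θ x - qpow θ (-x) = 2 * Complex.I * ((Real.sin (x * θ) : ℝ) : ℂ) := by
  have h1 : Complex.I * ((θ * x : ℝ) : ℂ) = ((x * θ : ℝ) : ℂ) * Complex.I := by
    push_cast; ring
  have h2 : Complex.I * ((θ * -x : ℝ) : ℂ) = -((x * θ : ℝ) : ℂ) * Complex.I := by
    push_cast; ring
  unfold qpow
  rw [h1, h2, Complex.ofReal_sin, Complex.sin]
  linear_combination (Complex.exp (((x * θ : ℝ) : ℂ) * Complex.I) -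
    Complex.exp (-((x * θ : ℝ) : ℂ) * Complex.I)) * Complex.I_sq

/-- The denominator `q - q⁻¹` of the `q`-numbers. -/
def qdiff (θ : ℝ) : ℂ := qpow θ 1 - qpow θ (-1)

lemma qdiff_mul_qnum {θ : ℝ} (h : qdiff θ ≠ 0) (x : ℝ) :
    qdiff θ * qnum θ x = qpow θ x - qpow θ (-x) :=
  mul_div_cancel₀ _ h

lemma qnum_one {θ : ℝ} (h : qdiff θ ≠ 0) : qnum θ 1 = 1 := div_self h

lemma qnum_eq_zero {θ : ℝ} (h : qdiff θ = 0) (x : ℝ) : qnum θ x = 0 := by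
  unfold qnum
  rw [show qpow θ 1 - qpow θ (-1) = 0 from h, div_zero]

lemma qnum_two_mul (θ x : ℝ) :
    qnum θ (2 * x) = (qpow θ x + qpow θ (-x)) * qnum θ x := by
  unfold qnum
  rw [two_mul, neg_add, qpow_add, qpow_add]
  ring

lemma csqrt_zero : csqrt 0 = 0 := by simp [csqrt]

lemma csqrt_one : csqrt 1 = 1 := by simp [csqrt]

/-! ### The representations in coordinates -/

lemma rho_uq (θ : ℝ) (n : ℕ) (g : UqGen) : rho θ n (uq θ g) = rhoGen θ n g :=
  Uq.lift_uq ..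

/-- The coefficient of `e_{m+1}` in `X e_m`, equal to that of `e_m` in `Y e_{m+1}`, where
`m = i - n / 2`. -/
def ladder (θ : ℝ) (n i : ℕ) : ℂ := csqrt (qnum θ ((n : ℝ) - i) * qnum θ ((i : ℝ) + 1))

lemma ladder_mul_self (θ : ℝ) (n i : ℕ) :
    ladder θ n i * ladder θ n i = qnum θ ((n : ℝ) - i) * qnum θ ((i : ℝ) + 1) :=
  csqrt_mul_self _

lemma ladder_self (θ : ℝ) (n : ℕ) : ladder θ n n = 0 := by
  simp [ladder, qnum_zero, csqrt_zero]

lemma rhoGen_X_apply (θ : ℝ) (n : ℕ) (a b : Fin (n + 1)) :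
    rhoGen θ n .X a b = if (a : ℕ) = b + 1 then ladder θ n b else 0 := by
  simp only [rhoGen, Matrix.of_apply, ladder, wt]
  congr 4 <;> ring

lemma rhoGen_Y_apply (θ : ℝ) (n : ℕ) (a b : Fin (n + 1)) :
    rhoGen θ n .Y a b = if (b : ℕ) = a + 1 then ladder θ n a else 0 := by
  simp only [rhoGen, Matrix.of_apply, ladder, wt]
  split_ifs with h
  · rw [mul_comm, h]
    push_cast
    congr 3 <;> ring
  · rfl

lemma rhoGen_X_transpose (θ : ℝ) (n : ℕ) : (rhoGen θ n .X)ᵀ = rhoGen θ n .Y := by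
  ext a b
  rw [Matrix.transpose_apply, rhoGen_X_apply, rhoGen_Y_apply]

lemma rhoGen_Y_transpose (θ : ℝ) (n : ℕ) : (rhoGen θ n .Y)ᵀ = rhoGen θ n .X := by
  rw [← rhoGen_X_transpose, Matrix.transpose_transpose]

lemma rhoGen_k_transpose (θ : ℝ) (n : ℕ) : (rhoGen θ n .k)ᵀ = rhoGen θ n .k :=
  Matrix.diagonal_transpose _

lemma rhoGen_kinv_transpose (θ : ℝ) (n : ℕ) : (rhoGen θ n .kinv)ᵀ = rhoGen θ n .kinv :=
  Matrix.diagonal_transpose _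

lemma rhoGen_k_X (θ : ℝ) (n : ℕ) :
    rhoGen θ n .k * rhoGen θ n .X = qpow θ 1 • (rhoGen θ n .X * rhoGen θ n .k) := by
  simpa [rho_uq] using congrArg (rho θ n) (uq_k_X θ)

lemma rhoGen_k_Y (θ : ℝ) (n : ℕ) :
    rhoGen θ n .k * rhoGen θ n .Y = qpow θ (-1) • (rhoGen θ n .Y * rhoGen θ n .k) := by
  simpa [rho_uq] using congrArg (rho θ n) (uq_k_Y θ)

lemma rhoGen_k_kinv (θ : ℝ) (n : ℕ) : rhoGen θ n .k * rhoGen θ n .kinv = 1 := by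
  simpa [rho_uq] using congrArg (rho θ n) (uq_k_kinv θ)

/-- The scalar by which the Casimir element acts on `V^K`, `K = n / 2`. -/
def casVal (θ : ℝ) (n : ℕ) : ℂ := qpow θ ((n : ℝ) + 1) + qpow θ (-((n : ℝ) + 1))

/-- Product-to-sum formula. At `q = -1` the left side is 0 by the convention on `q`-numbers, and the
hypothesis makes the right side vanish too. -/
lemma qdiff_sq_mul_qnum (θ x y : ℝ) (hxy : qdiff θ = 0 →
      qpow θ (x + y) + qpow θ (-(x + y)) = qpow θ (x - y) + qpow θ (-(x - y))) :
    qdiff θ ^ 2 * (qnum θ x * qnum θ y) =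
      qpow θ (x + y) + qpow θ (-(x + y)) - (qpow θ (x - y) + qpow θ (-(x - y))) := by
  by_cases h : qdiff θ = 0
  · rw [hxy h, h]; ring
  · rw [show qdiff θ ^ 2 * (qnum θ x * qnum θ y) =
      (qdiff θ * qnum θ x) * (qdiff θ * qnum θ y) by ring, qdiff_mul_qnum h, qdiff_mul_qnum h]
    rw [show -(x + y) = -x + -y by ring, show -(x - y) = -x + y by ring,
      show x - y = x + -y by ring]
    simp only [qpow_add]
    ring

lemma qpow_two_of_qdiff {θ : ℝ} (h : qdiff θ = 0) : qpow θ 2 = 1 := by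
  have : qpow θ 1 = qpow θ (-1) := sub_eq_zero.mp h
  rw [show (2 : ℝ) = 1 + 1 by norm_num, qpow_add]
  nth_rewrite 2 [this]
  exact qpow_mul_neg θ 1

lemma qpow_two_mul_nat_of_qdiff {θ : ℝ} (h : qdiff θ = 0) (j : ℕ) : qpow θ (2 * j) = 1 := by
  induction j with
  | zero => simp [qpow_zero]
  | succ j ih =>
    rw [show (2 * ((j + 1 : ℕ) : ℝ)) = 2 * j + 2 by push_cast; ring, qpow_add, ih,
      qpow_two_of_qdiff h, one_mul]

/-- An integer second argument discharges the hypothesis: `x + j` and `x - j` differ by `2j`, and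
`q² = 1` gives `q^{2j} = 1`. -/
lemma qdiff_sq_mul_qnum_nat (θ : ℝ) (x : ℝ) (j : ℕ) :
    qdiff θ ^ 2 * (qnum θ x * qnum θ j) =
      qpow θ (x + j) + qpow θ (-(x + j)) - (qpow θ (x - j) + qpow θ (-(x - j))) := by
  apply qdiff_sq_mul_qnum
  intro h
  have h1 := qpow_two_mul_nat_of_qdiff h j
  rw [show x + j = (x - j) + 2 * j by ring, neg_add, qpow_add, qpow_add, qpow_neg _ (2 * (j : ℝ)),
    h1]
  simp

/-- `X Y` is diagonal with entries `[J+m][J-m+1]`, and `J + m` is a natural number, so the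
product-to-sum formula applies also at `q = -1`. -/
lemma casimir_X_Y (θ : ℝ) (n : ℕ) :
    qdiff θ ^ 2 • (rhoGen θ n .X * rhoGen θ n .Y) +
      qpow θ (-1) • (rhoGen θ n .k * rhoGen θ n .k) +
      qpow θ 1 • (rhoGen θ n .kinv * rhoGen θ n .kinv) = casVal θ n • 1 := by
  ext a b
  simp only [Matrix.add_apply, Matrix.smul_apply, rhoGen_X_Y_apply, smul_eq_mul]
  by_cases hab : a = b
  · subst hab
    simp only [rhoGen, Matrix.diagonal_mul_diagonal, Matrix.diagonal_apply_eq, if_true,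
      Matrix.one_apply_eq, casVal]
    rw [show (n / 2 + wt n a : ℝ) = ((a : ℕ) : ℝ) by simp [wt],
      mul_comm (qnum θ ((a : ℕ) : ℝ)), qdiff_sq_mul_qnum_nat]
    simp only [← qpow_add]
    simp only [wt]
    ring_nf
  · simp [rhoGen, Matrix.one_apply_ne hab, hab]

lemma casimir_Y_X (θ : ℝ) (n : ℕ) :
    qdiff θ ^ 2 • (rhoGen θ n .Y * rhoGen θ n .X) +
      qpow θ 1 • (rhoGen θ n .k * rhoGen θ n .k) +
      qpow θ (-1) • (rhoGen θ n .kinv * rhoGen θ n .kinv) = casVal θ n • 1 := by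
  ext a b
  simp only [Matrix.add_apply, Matrix.smul_apply, rhoGen_Y_X_apply, smul_eq_mul]
  by_cases hab : a = b
  · subst hab
    simp only [rhoGen, Matrix.diagonal_mul_diagonal, Matrix.diagonal_apply_eq, if_true,
      Matrix.one_apply_eq, casVal]
    rw [show (n / 2 + wt n a + 1 : ℝ) = (((a : ℕ) + 1 : ℕ) : ℝ) by simp [wt],
      qdiff_sq_mul_qnum_nat]
    simp only [← qpow_add]
    simp only [wt]
    push_cast
    ring_nf
  · simp [rhoGen, Matrix.one_apply_ne hab, hab]

/-- The factor `q - q⁻¹` makes the geometric sum of the `q^{2m}` telescope; keeping it on the left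
avoids dividing by zero at `q = -1`. -/
lemma qdiff_mul_trace_k_sq (θ : ℝ) (n : ℕ) :
    qdiff θ * (rhoGen θ n .k * rhoGen θ n .k).trace =
      qpow θ ((n : ℝ) + 1) - qpow θ (-((n : ℝ) + 1)) := by
  simp only [rhoGen, Matrix.diagonal_mul_diagonal, Matrix.trace_diagonal, Finset.mul_sum, wt]
  rw [Fin.sum_univ_eq_sum_range
    (fun i => qdiff θ * (qpow θ ((i : ℝ) - n / 2) * qpow θ ((i : ℝ) - n / 2))) (n + 1)]
  rw [Finset.sum_congr rfl (g := fun i : ℕ => qpow θ (2 * ((i + 1 : ℕ) : ℝ) - n - 1) -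
    qpow θ (2 * (i : ℝ) - n - 1)), Finset.sum_range_sub (fun i => qpow θ (2 * (i : ℝ) - n - 1))]
  · push_cast
    congr 2 <;> ring
  · intro i _
    rw [qdiff, sub_mul, ← qpow_add, ← qpow_add, ← qpow_add]
    push_cast
    congr 2 <;> ring

lemma qdiff_mul_trace_kinv_sq (θ : ℝ) (n : ℕ) :
    qdiff θ * (rhoGen θ n .kinv * rhoGen θ n .kinv).trace =
      qpow θ ((n : ℝ) + 1) - qpow θ (-((n : ℝ) + 1)) := by
  -- Replacing `q` by `q⁻¹` exchanges `k` with its inverse and changes the sign of `q - q⁻¹`.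
  have h := qdiff_mul_trace_k_sq (-θ) n
  have e : ∀ x, qpow (-θ) x = qpow θ (-x) := fun x => by simp [qpow]
  have e1 : rhoGen (-θ) n .k = rhoGen θ n .kinv := by simp [rhoGen, e]
  rw [e1, e, e, neg_neg, qdiff, e, e, neg_neg] at h
  rw [qdiff]
  linear_combination -h

lemma qtr_eq (θ : ℝ) (n : ℕ) (Z : Matrix (Fin (n + 1)) (Fin (n + 1)) ℂ) :
    qtr θ n Z = (Z * (rhoGen θ n .kinv * rhoGen θ n .kinv)).trace := by
  simp [qtr, grouplike, rho_uq]

lemma qdim_eq_qnum {θ : ℝ} (h : qdiff θ ≠ 0) (n : ℕ) : qdim θ n = qnum θ ((n : ℝ) + 1) := by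
  apply mul_left_cancel₀ h
  rw [qdim, qtr_eq, one_mul, qdiff_mul_trace_kinv_sq, qdiff_mul_qnum h]

lemma qtr_smul_one (θ : ℝ) (n : ℕ) (c : ℂ) : qtr θ n (c • 1) = c * qdim θ n := by
  simp [qdim, qtr]

/-! ### Block matrices over the spin-`1/2` factor -/

/-- The operator on `V^{1/2} ⊗ V` with the given blocks with respect to the basis
`e_{-1/2}, e_{1/2}`. -/
def blk {m : ℕ} (A B C D : Matrix (Fin m) (Fin m) ℂ) :
    Matrix (Fin (1 + 1) × Fin m) (Fin (1 + 1) × Fin m) ℂ :=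
  Matrix.of fun p r => (!![A, B; C, D] : Matrix (Fin 2) (Fin 2) _) p.1 r.1 p.2 r.2

section blk

variable {m : ℕ} (A B C D A' B' C' D' : Matrix (Fin m) (Fin m) ℂ)

lemma blk_ext {M N : Matrix (Fin (1 + 1) × Fin m) (Fin (1 + 1) × Fin m) ℂ}
    (h00 : ∀ i j, M (0, i) (0, j) = N (0, i) (0, j))
    (h01 : ∀ i j, M (0, i) (1, j) = N (0, i) (1, j))
    (h10 : ∀ i j, M (1, i) (0, j) = N (1, i) (0, j))
    (h11 : ∀ i j, M (1, i) (1, j) = N (1, i) (1, j)) : M = N := by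
  ext ⟨s, i⟩ ⟨t, j⟩
  fin_cases s <;> fin_cases t
  exacts [h00 i j, h01 i j, h10 i j, h11 i j]

lemma blk_mul : blk A B C D * blk A' B' C' D' =
    blk (A * A' + B * C') (A * B' + B * D') (C * A' + D * C') (C * B' + D * D') := by
  apply blk_ext <;> intro i j <;>
    simp [blk, Matrix.mul_apply, Fintype.sum_prod_type, Fin.sum_univ_two]

lemma blk_add : blk A B C D + blk A' B' C' D' = blk (A + A') (B + B') (C + C') (D + D') := by
  apply blk_ext <;> intro i j <;> simp [blk]

lemma blk_sub : blk A B C D - blk A' B' C' D' = blk (A - A') (B - B') (C - C') (D - D') := by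
  apply blk_ext <;> intro i j <;> simp [blk]

lemma blk_smul (c : ℂ) : c • blk A B C D = blk (c • A) (c • B) (c • C) (c • D) := by
  apply blk_ext <;> intro i j <;> simp [blk]

lemma blk_one : (1 : Matrix (Fin (1 + 1) × Fin m) (Fin (1 + 1) × Fin m) ℂ) = blk 1 0 0 1 := by
  apply blk_ext <;> intro i j <;> simp [blk, Matrix.one_apply]

lemma blk_trace : (blk A B C D).trace = A.trace + D.trace := by
  simp [blk, Matrix.trace, Fintype.sum_prod_type, Fin.sum_univ_two]

end blk

lemma wt_one_zero : wt 1 0 = -(1 / 2) := by norm_num [wt]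

lemma wt_one_one : wt 1 1 = 1 / 2 := by norm_num [wt]

lemma qtrLeft_blk (θ : ℝ) (n : ℕ) (A B C D : Matrix (Fin (n + 1)) (Fin (n + 1)) ℂ) :
    qtrLeft θ 1 n (blk A B C D) = qpow θ 1 • A + qpow θ (-1) • D := by
  ext i j
  simp only [qtrLeft, qtr_eq, Matrix.of_apply, rhoGen, Matrix.diagonal_mul_diagonal, Matrix.trace,
    Matrix.diag_apply, Matrix.mul_diagonal, ← qpow_add]
  rw [Fin.sum_univ_two, wt_one_zero, wt_one_one]
  norm_num [blk]
  ring

lemma qtrLeft_smul (θ : ℝ) (a n : ℕ) (c : ℂ)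
    (Z : Matrix (Fin (a + 1) × Fin (n + 1)) (Fin (a + 1) × Fin (n + 1)) ℂ) :
    qtrLeft θ a n (c • Z) = c • qtrLeft θ a n Z := by
  ext i j
  simp only [qtrLeft, qtr, Matrix.of_apply, Matrix.smul_apply, ← Matrix.trace_smul,
    ← Matrix.smul_mul]
  rfl

/-! ### The monodromy matrix -/

/-- At `q = -1` the ladder coefficient is 0 instead of 1, but the `R`-matrix contains it only
together with a factor `q - q⁻¹`. -/
lemma qdiff_mul_ladder_one (θ : ℝ) : qdiff θ * ladder θ 1 0 = qdiff θ := by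
  by_cases h : qdiff θ = 0
  · simp [h]
  · simp [ladder, qnum_one h, csqrt_one]

lemma qdiff_div_qfact_one (θ : ℝ) : qdiff θ / qfact θ 1 = qdiff θ := by
  by_cases h : qdiff θ = 0
  · simp [h]
  · simp [qfact, qnum_one h]

/-- The off-diagonal coefficient `q^{-1/2} (q - q⁻¹)` of the `R`-matrix. -/
def offCoeff (θ : ℝ) : ℂ := qdiff θ * qpow θ (-(1 / 2))

lemma Rmat_one_left (θ : ℝ) (n : ℕ) :
    Rmat θ 1 n = blk (rhoGen θ n .kinv) 0 (offCoeff θ • rhoGen θ n .Y) (rhoGen θ n .k) := by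
  unfold Rmat
  rw [Finset.sum_range_succ, Finset.sum_range_one, rho_uq, rho_uq]
  have h0 := qdiff_div_qfact_one θ
  have h1 := qdiff_mul_ladder_one θ
  change _ + (qdiff θ ^ 1 / _ * _) • _ = _
  rw [pow_one, h0]
  apply blk_ext <;> intro i j <;>
    simp only [Matrix.add_apply, Matrix.smul_apply, Matrix.diagonal_mul,
      Matrix.kroneckerMap_apply, pow_zero, pow_one, rhoGen_X_apply, smul_eq_mul, wt_one_zero,
      wt_one_one, blk, Matrix.of_apply, qfact]
  · simp [rhoGen, Matrix.one_apply, Matrix.diagonal_apply, qpow_zero]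
  · simp
  · simp [offCoeff]
    rw [show (-2⁻¹ : ℝ) = -1 + 2⁻¹ by norm_num, qpow_add]
    linear_combination (qpow θ (-1) * qpow θ 2⁻¹ * rhoGen θ n UqGen.Y i j) * h1
  · simp [rhoGen, Matrix.one_apply, Matrix.diagonal_apply, qpow_zero]

lemma rhoGen_one_Y_sq (θ : ℝ) : rhoGen θ 1 .Y ^ 2 = 0 := by
  ext a b
  rw [sq, Matrix.mul_apply, Fin.sum_univ_two]
  simp only [rhoGen_Y_apply]
  fin_cases a <;> fin_cases b <;> simp

lemma rhoGen_zero_X (θ : ℝ) : rhoGen θ 0 .X = 0 := by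
  ext a b
  rw [rhoGen_X_apply, if_neg (by omega), Matrix.zero_apply]

lemma RmatFlip_one_left (θ : ℝ) (n : ℕ) :
    RmatFlip θ 1 n = blk (rhoGen θ n .kinv) (offCoeff θ • rhoGen θ n .X) 0 (rhoGen θ n .k) := by
  have h0 := qdiff_div_qfact_one θ
  have h1 := qdiff_mul_ladder_one θ
  have hR : Rmat θ n 1 = Matrix.diagonal (fun p : Fin (n + 1) × Fin (1 + 1) =>
          qpow θ (2 * wt n p.1 * wt 1 p.2)) + (qdiff θ * qpow θ (-1)) •
        (Matrix.diagonal (fun p : Fin (n + 1) × Fin (1 + 1) =>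
          qpow θ (2 * wt n p.1 * wt 1 p.2 + (wt n p.1 - wt 1 p.2))) *
        (rhoGen θ n .X ⊗ₖ rhoGen θ 1 .Y)) := by
    unfold Rmat
    rw [Finset.sum_range_succ', rho_uq, rho_uq]
    refine (add_comm _ _).trans ?_
    congr 1
    · simp [qfact, qpow_zero]
    -- For `n = 0` the sum stops before `j = 1`, and the extra term on the right is 0 because `X =
    -- 0` on `V^0`. For larger `n` the terms with `j ≥ 2` die because `Y² = 0` on `V^{1/2}`.
    · cases n with
      | zero => simp [rhoGen_zero_X]
      | succ n =>
        rw [Finset.sum_range_succ', Finset.sum_eq_zero, zero_add]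
        · change (qdiff θ ^ 1 / _ * _) • _ = _
          rw [pow_one, h0]
          norm_num
        · intro j _
          rw [show j + 1 + 1 = 2 + j by ring, pow_add (rhoGen θ 1 .Y), rhoGen_one_Y_sq]
          simp
  have h2 : ∀ x : ℝ, 2 * x * 2⁻¹ = x := fun x => by ring
  unfold RmatFlip
  rw [hR]
  apply blk_ext <;> intro i j <;>
    simp only [Matrix.submatrix_apply, Prod.swap, Matrix.add_apply, Matrix.smul_apply,
      Matrix.diagonal_mul, Matrix.diagonal_apply, Prod.mk.injEq,
      Matrix.kroneckerMap_apply, rhoGen_Y_apply, smul_eq_mul, wt_one_zero,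
      wt_one_one, blk, Matrix.of_apply]
  · simp [rhoGen, Matrix.diagonal_apply, h2]
  · simp [offCoeff]
    rw [show -(2 * wt n i * 2⁻¹) + (wt n i + 2⁻¹) = 2⁻¹ by ring,
      show (-2⁻¹ : ℝ) = -1 + 2⁻¹ by norm_num, qpow_add]
    linear_combination (qpow θ (-1) * qpow θ 2⁻¹ * rhoGen θ n UqGen.X i j) * h1
  · simp
  · simp [rhoGen, Matrix.diagonal_apply, h2]

lemma offCoeff_sq (θ : ℝ) : offCoeff θ * offCoeff θ = qpow θ (-1) * qdiff θ ^ 2 := by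
  rw [offCoeff, show (-1 : ℝ) = -(1 / 2) + -(1 / 2) by norm_num, qpow_add]
  ring

/-- The upper left block of the product is `k⁻² + q⁻¹ (q - q⁻¹)² X Y`; the Casimir relation trades
it for an expression in `k²` alone. -/
lemma RR_one_left (θ : ℝ) (n : ℕ) :
    RR θ 1 n = blk
      (qpow θ (-1) • casVal θ n • 1 - qpow θ (-2) • (rhoGen θ n .k * rhoGen θ n .k))
      (offCoeff θ • (rhoGen θ n .X * rhoGen θ n .k))
      (offCoeff θ • (rhoGen θ n .k * rhoGen θ n .Y))
      (rhoGen θ n .k * rhoGen θ n .k) := by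
  rw [RR, RmatFlip_one_left, Rmat_one_left, blk_mul, ← casimir_X_Y]
  simp only [smul_mul_assoc, mul_smul_comm, smul_smul, offCoeff_sq, smul_add, zero_mul, mul_zero,
    zero_add, ← qpow_add]
  congr 1
  norm_num [qpow_zero]
  abel

lemma qtrLeft_RR (θ : ℝ) (n : ℕ) : qtrLeft θ 1 n (RR θ 1 n) = casVal θ n • 1 := by
  rw [RR_one_left, qtrLeft_blk, smul_sub, smul_smul, smul_smul, qpow_mul_neg, one_mul,
    smul_smul, ← qpow_add]
  norm_num

lemma kap_ne_zero (θ : ℝ) (n : ℕ) : kap θ n ≠ 0 := qpow_ne_zero _ _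

lemma centralRep_eq_qtrLeft (θ : ℝ) (a n : ℕ) :
    centralRep θ a n = qtrLeft θ a n (RR θ a n) := by
  rw [centralRep, holonomyRep, qtrLeft_smul, smul_smul, mul_inv_cancel₀ (kap_ne_zero θ a),
    one_smul]

lemma centralRepTrunc_eq_qtrLeft (θ : ℝ) (a n : ℕ) (P) :
    centralRepTrunc θ a n P = qtrLeft θ a n (RR θ a n * P) := by
  rw [centralRepTrunc, holonomyRepTrunc, qtrLeft_smul, smul_smul,
    mul_inv_cancel₀ (kap_ne_zero θ a), one_smul]

lemma casVal_eq_cos (θ : ℝ) (n : ℕ) :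
    casVal θ n = ((2 * Real.cos (((n : ℝ) + 1) * θ) : ℝ) : ℂ) :=
  qpow_add_qpow_neg θ _

lemma sMat_one_left (θ : ℝ) (n : ℕ) : sMat θ 1 n = casVal θ n * qdim θ n := by
  rw [sMat, qtrLeft_RR, qtr_smul_one]

/-! ### Spectral decomposition of the monodromy on `V^{1/2} ⊗ V^K` -/

/-- A Cayley–Hamilton identity for a 2×2 matrix with noncommuting entries. By
`qpow_neg_one_mul_casVal` its roots are `q^n` and `q^{-(n+2)}`. -/
lemma RR_sq (θ : ℝ) (n : ℕ) :
    RR θ 1 n * RR θ 1 n = (qpow θ (-1) * casVal θ n) • RR θ 1 n - qpow θ (-2) • 1 := by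
  have hX : rhoGen θ n .k * rhoGen θ n .k * rhoGen θ n .X =
      qpow θ 2 • (rhoGen θ n .X * (rhoGen θ n .k * rhoGen θ n .k)) := by
    rw [mul_assoc, rhoGen_k_X, mul_smul_comm, ← mul_assoc, rhoGen_k_X, smul_mul_assoc, smul_smul,
      ← qpow_add, mul_assoc]
    norm_num
  have hY : rhoGen θ n .k * rhoGen θ n .k * rhoGen θ n .Y =
      qpow θ (-2) • (rhoGen θ n .Y * (rhoGen θ n .k * rhoGen θ n .k)) := by
    rw [mul_assoc, rhoGen_k_Y, mul_smul_comm, ← mul_assoc, rhoGen_k_Y, smul_mul_assoc, smul_smul,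
      ← qpow_add, mul_assoc]
    norm_num
  have hinv : rhoGen θ n .k * rhoGen θ n .k * (rhoGen θ n .kinv * rhoGen θ n .kinv) = 1 := by
    rw [mul_assoc, ← mul_assoc (rhoGen θ n .k) (rhoGen θ n .kinv), rhoGen_k_kinv, one_mul,
      rhoGen_k_kinv]
  have hc1 := casimir_X_Y θ n
  have hc2 := casimir_Y_X θ n
  have hkk : rhoGen θ n .k * (rhoGen θ n .k * rhoGen θ n .k) =
    (rhoGen θ n .k * rhoGen θ n .k) * rhoGen θ n .k := (mul_assoc _ _ _).symm
  have e0 : qpow θ (-2) * qpow θ 2 = 1 := by rw [mul_comm, qpow_mul_neg]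
  have e1 : qpow θ (-1) * qpow θ (-1) = qpow θ (-2) := by rw [← qpow_add]; norm_num
  have e2 : qpow θ 1 * qpow θ (-1) = 1 := qpow_mul_neg θ 1
  rw [RR_one_left, blk_mul, blk_one, blk_smul, blk_smul, blk_sub]
  have hXk : rhoGen θ n .X * rhoGen θ n .k * (rhoGen θ n .k * rhoGen θ n .Y) =
      qpow θ (-2) • (rhoGen θ n .k * rhoGen θ n .k * (rhoGen θ n .X * rhoGen θ n .Y)) := by
    rw [← mul_assoc (rhoGen θ n .k * rhoGen θ n .k), hX, smul_mul_assoc, smul_smul, e0, one_smul]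
    simp only [mul_assoc]
  have hYk : rhoGen θ n .k * rhoGen θ n .Y * (rhoGen θ n .X * rhoGen θ n .k) =
      rhoGen θ n .k * rhoGen θ n .k * (rhoGen θ n .Y * rhoGen θ n .X) := by
    have : rhoGen θ n .X * rhoGen θ n .k = qpow θ (-1) • (rhoGen θ n .k * rhoGen θ n .X) := by
      rw [rhoGen_k_X, smul_smul, mul_comm, e2, one_smul]
    rw [this, mul_smul_comm, mul_assoc, ← mul_assoc (rhoGen θ n .Y),
      show rhoGen θ n .Y * rhoGen θ n .k = qpow θ 1 • (rhoGen θ n .k * rhoGen θ n .Y) by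
        rw [rhoGen_k_Y, smul_smul, e2, one_smul]]
    rw [smul_mul_assoc, mul_smul_comm, smul_smul, mul_comm (qpow θ (-1)), e2, one_smul]
    simp only [mul_assoc]
  -- Multiplying the Casimir relations by `q⁻¹ k²` removes `k⁻²`. The upper left block needs the
  -- form with `X Y`, the lower right block the form with `Y X`.
  have hc1' := congrArg (fun M => qpow θ (-1) • (rhoGen θ n .k * rhoGen θ n .k * M)) hc1
  have hc2' := congrArg (fun M => qpow θ (-1) • (rhoGen θ n .k * rhoGen θ n .k * M)) hc2
  simp only [mul_add, mul_smul_comm, mul_one, hinv, smul_add, smul_smul,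
    mul_comm (qpow θ (-1)) (qpow θ 1), e2, e1] at hc1' hc2'
  congr 1
  · simp only [sub_mul, mul_sub, smul_mul_assoc, mul_smul_comm, one_mul, mul_one, hXk, smul_smul]
    rw [← mul_assoc (offCoeff θ), offCoeff_sq]
    linear_combination (norm := module) qpow θ (-2) • hc1'
  · simp only [sub_mul, smul_mul_assoc, mul_smul_comm, one_mul, smul_zero, sub_zero, smul_smul]
    rw [← mul_assoc _ (rhoGen θ n .X), hX, mul_assoc, hkk, smul_mul_assoc, smul_smul, mul_assoc, e0]
    module
  · simp only [mul_sub, smul_mul_assoc, mul_smul_comm, mul_one, smul_zero, sub_zero, smul_smul]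
    rw [show rhoGen θ n .k * rhoGen θ n .k * (rhoGen θ n .k * rhoGen θ n .Y) =
        qpow θ (-2) • (rhoGen θ n .k * rhoGen θ n .Y * (rhoGen θ n .k * rhoGen θ n .k)) by
      rw [mul_assoc (rhoGen θ n .k), mul_assoc (rhoGen θ n .k) (rhoGen θ n .Y), ← mul_smul_comm,
        ← hY, mul_assoc (rhoGen θ n .k) (rhoGen θ n .k)]]
    module
  · simp only [smul_mul_assoc, mul_smul_comm, hYk, smul_smul]
    rw [offCoeff_sq]
    linear_combination (norm := module) hc2'

lemma qpow_neg_one_mul_casVal (θ : ℝ) (n : ℕ) :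
    qpow θ (-1) * casVal θ n = qpow θ n + qpow θ (-((n : ℝ) + 2)) := by
  rw [casVal, mul_add, ← qpow_add, ← qpow_add]
  congr 2 <;> ring

/-- The coefficients are the dimensions `n + 2` and `n` of the components of spin `K + 1/2` and `K -
1/2`; this is used later to count ranks. -/
lemma trace_RR (θ : ℝ) (n : ℕ) :
    (RR θ 1 n).trace = (n + 2) * qpow θ n + n * qpow θ (-((n : ℝ) + 2)) := by
  have h := qdiff_mul_trace_k_sq θ n
  have e : (1 - qpow θ (-2)) = qpow θ (-1) * qdiff θ := by
    rw [qdiff, mul_sub, ← qpow_add, ← qpow_add]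
    norm_num [qpow_zero]
  rw [RR_one_left, blk_trace, Matrix.trace_sub, smul_smul, Matrix.trace_smul, Matrix.trace_smul,
    qpow_neg_one_mul_casVal, Matrix.trace_one, Fintype.card_fin, smul_eq_mul, smul_eq_mul]
  have h2 : qpow θ (-1) * (qpow θ ((n : ℝ) + 1) - qpow θ (-((n : ℝ) + 1))) =
      qpow θ n - qpow θ (-((n : ℝ) + 2)) := by
    rw [mul_sub, ← qpow_add, ← qpow_add]
    congr 2 <;> ring
  push_cast
  linear_combination qpow θ (-1) * h +
    (rhoGen θ n UqGen.k * rhoGen θ n UqGen.k).trace * e + h2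

/-! ### The coproduct representation on `V^{1/2} ⊗ V^K` and its Casimir -/

lemma rhoTensor_tmul (θ : ℝ) (a b : ℕ) (x y : Uq θ) :
    rhoTensor θ a b (x ⊗ₜ y) = rho θ a x ⊗ₖ rho θ b y := by
  simp [rhoTensor]

lemma rhoBox_uq (θ : ℝ) (a b : ℕ) (g : UqGen) :
    rhoBox θ a b (uq θ g) = rhoTensor θ a b (coprodGen θ g) := by
  simp [rhoBox, coprod, Uq.lift_uq]

lemma rhoBox_k (θ : ℝ) (a b : ℕ) :
    rhoBox θ a b (uq θ .k) = rhoGen θ a .k ⊗ₖ rhoGen θ b .k := by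
  simp [rhoBox_uq, coprodGen, rhoTensor_tmul, rho_uq]

lemma rhoBox_kinv (θ : ℝ) (a b : ℕ) :
    rhoBox θ a b (uq θ .kinv) = rhoGen θ a .kinv ⊗ₖ rhoGen θ b .kinv := by
  simp [rhoBox_uq, coprodGen, rhoTensor_tmul, rho_uq]

lemma rhoBox_X (θ : ℝ) (a b : ℕ) :
    rhoBox θ a b (uq θ .X) =
      rhoGen θ a .X ⊗ₖ rhoGen θ b .k + rhoGen θ a .kinv ⊗ₖ rhoGen θ b .X := by
  simp [rhoBox_uq, coprodGen, rhoTensor_tmul, rho_uq]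

lemma rhoBox_Y (θ : ℝ) (a b : ℕ) :
    rhoBox θ a b (uq θ .Y) =
      rhoGen θ a .Y ⊗ₖ rhoGen θ b .k + rhoGen θ a .kinv ⊗ₖ rhoGen θ b .Y := by
  simp [rhoBox_uq, coprodGen, rhoTensor_tmul, rho_uq]

lemma ladder_one_zero {θ : ℝ} (h : qdiff θ ≠ 0) : ladder θ 1 0 = 1 := by
  simp [ladder, qnum_one h, csqrt_one]

lemma rhoBox_one_k (θ : ℝ) (n : ℕ) :
    rhoBox θ 1 n (uq θ .k) =
      blk (qpow θ (-(1 / 2)) • rhoGen θ n .k) 0 0 (qpow θ (1 / 2) • rhoGen θ n .k) := by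
  rw [rhoBox_k]
  apply blk_ext <;> intro i j <;>
    simp [blk, rhoGen, Matrix.kroneckerMap_apply, wt_one_zero, wt_one_one]

lemma rhoBox_one_kinv (θ : ℝ) (n : ℕ) :
    rhoBox θ 1 n (uq θ .kinv) =
      blk (qpow θ (1 / 2) • rhoGen θ n .kinv) 0 0 (qpow θ (-(1 / 2)) • rhoGen θ n .kinv) := by
  rw [rhoBox_kinv]
  apply blk_ext <;> intro i j <;>
    simp [blk, rhoGen, Matrix.kroneckerMap_apply, wt_one_zero, wt_one_one]

lemma rhoBox_one_X {θ : ℝ} (h : qdiff θ ≠ 0) (n : ℕ) :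
    rhoBox θ 1 n (uq θ .X) =
      blk (qpow θ (1 / 2) • rhoGen θ n .X) 0 (rhoGen θ n .k)
        (qpow θ (-(1 / 2)) • rhoGen θ n .X) := by
  have h1 := ladder_one_zero h
  rw [rhoBox_X]
  apply blk_ext <;> intro i j <;>
    simp only [blk, Matrix.add_apply, Matrix.kroneckerMap_apply, rhoGen_X_apply θ 1] <;>
    simp [rhoGen, wt_one_zero, wt_one_one, h1]

lemma rhoBox_one_Y {θ : ℝ} (h : qdiff θ ≠ 0) (n : ℕ) :
    rhoBox θ 1 n (uq θ .Y) =
      blk (qpow θ (1 / 2) • rhoGen θ n .Y) (rhoGen θ n .k) 0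
        (qpow θ (-(1 / 2)) • rhoGen θ n .Y) := by
  have h1 := ladder_one_zero h
  rw [rhoBox_Y]
  apply blk_ext <;> intro i j <;>
    simp only [blk, Matrix.add_apply, Matrix.kroneckerMap_apply, rhoGen_Y_apply θ 1] <;>
    simp [rhoGen, wt_one_zero, wt_one_one, h1]

/-- The Casimir element `(q - q⁻¹)² Y X + q q^H + q⁻¹ q^{-H}`. -/
def casimir (θ : ℝ) : Uq θ :=
  qdiff θ ^ 2 • (uq θ .Y * uq θ .X) + qpow θ 1 • (uq θ .k * uq θ .k) +
    qpow θ (-1) • (uq θ .kinv * uq θ .kinv)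

lemma rho_casimir (θ : ℝ) (n : ℕ) : rho θ n (casimir θ) = casVal θ n • 1 := by
  rw [← casimir_Y_X]
  simp [casimir, rho_uq]

/-- This links the monodromy to representation theory: intertwiners respect the Casimir, so they
become eigenvectors of `R'R`. -/
lemma rhoBox_casimir {θ : ℝ} (h : qdiff θ ≠ 0) (n : ℕ) :
    rhoBox θ 1 n (casimir θ) =
      (qpow θ 2 - 1) • RR θ 1 n + (qpow θ (-1) * casVal θ n) • 1 := by
  have e0 : qpow θ 1 = qpow θ (1 / 2) ^ 2 := qpow_one_eq θ
  have e1 : qpow θ 2 = qpow θ (1 / 2) ^ 4 := by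
    rw [show (2 : ℝ) = 1 + 1 by norm_num, qpow_add, e0]; norm_num; ring
  have hr := qpow_ne_zero θ (1 / 2)
  have hc := casimir_Y_X θ n
  have hXk : rhoGen θ n .k * rhoGen θ n .X = qpow θ 1 • (rhoGen θ n .X * rhoGen θ n .k) :=
    rhoGen_k_X θ n
  have hYk : rhoGen θ n .Y * rhoGen θ n .k = qpow θ 1 • (rhoGen θ n .k * rhoGen θ n .Y) := by
    rw [rhoGen_k_Y, smul_smul, qpow_mul_neg, one_smul]
  simp only [casimir, map_add, map_smul, map_mul, rhoBox_one_k, rhoBox_one_kinv, rhoBox_one_X h,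
    rhoBox_one_Y h, RR_one_left, blk_mul, blk_smul, blk_add, blk_one]
  simp only [smul_mul_assoc, mul_smul_comm, zero_mul, mul_zero, add_zero, zero_add, smul_zero,
    hXk, hYk]
  -- All powers of `q` are written in the single letter `q^{1/2}`. The two diagonal blocks then
  -- reduce to `q` and `q⁻¹` times the Casimir relation on `V^K`.
  simp only [offCoeff, qdiff, qpow_neg, e1, e0] at hc ⊢
  congr 1
  · linear_combination (norm := skip) (qpow θ (1 / 2) ^ 2) • hc
    match_scalars <;> field_simp <;> ring
  · match_scalars; field_simp
  · match_scalars; field_simp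
  · linear_combination (norm := skip) (qpow θ (1 / 2) ^ 2)⁻¹ • hc
    match_scalars <;> field_simp <;> ring

lemma qpow_two_sub_one_ne_zero {θ : ℝ} (h : qdiff θ ≠ 0) : qpow θ 2 - 1 ≠ 0 := by
  have e : qpow θ 2 - 1 = qpow θ 1 * qdiff θ := by
    rw [qdiff, mul_sub, ← qpow_add, ← qpow_add]
    norm_num [qpow_zero]
  rw [e]
  exact mul_ne_zero (qpow_ne_zero _ _) h

lemma casVal_sub_eq (θ : ℝ) (t : ℕ) :
    casVal θ t - qpow θ (-1) * casVal θ (t + 1) =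
      (qpow θ 2 - 1) * qpow θ (-(((t + 1 : ℕ) : ℝ) + 2)) := by
  rw [qpow_neg_one_mul_casVal, casVal, sub_mul, ← qpow_add]
  push_cast
  rw [show (2 + -((t : ℝ) + 1 + 2)) = -((t : ℝ) + 1) by ring]
  ring

/-- Comparing Casimir values on both sides and dividing by `q² - 1`, which is nonzero for `q² ≠ 1`,
gives the eigenvalue; see `casVal_sub_eq`. -/
lemma RR_mul_intertwiner {θ : ℝ} (h : qdiff θ ≠ 0) {t : ℕ}
    {E : Matrix (Fin (1 + 1) × Fin (t + 1 + 1)) (Fin (t + 1)) ℂ}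
    (hE : rhoBox θ 1 (t + 1) (casimir θ) * E = E * rho θ t (casimir θ)) :
    RR θ 1 (t + 1) * E = qpow θ (-(((t + 1 : ℕ) : ℝ) + 2)) • E := by
  rw [rhoBox_casimir h, rho_casimir, Matrix.add_mul, Matrix.smul_mul, Matrix.smul_mul,
    Matrix.one_mul, Matrix.mul_smul, Matrix.mul_one] at hE
  apply smul_right_injective _ (qpow_two_sub_one_ne_zero h)
  simp only [smul_smul, ← casVal_sub_eq, sub_smul, ← hE]
  abel

lemma intertwiner_mul_RR {θ : ℝ} (h : qdiff θ ≠ 0) {t : ℕ}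
    {C : Matrix (Fin (t + 1)) (Fin (1 + 1) × Fin (t + 1 + 1)) ℂ}
    (hC : C * rhoBox θ 1 (t + 1) (casimir θ) = rho θ t (casimir θ) * C) :
    C * RR θ 1 (t + 1) = qpow θ (-(((t + 1 : ℕ) : ℝ) + 2)) • C := by
  rw [rhoBox_casimir h, rho_casimir, Matrix.mul_add, Matrix.mul_smul, Matrix.smul_mul,
    Matrix.one_mul, Matrix.mul_smul, Matrix.mul_one] at hC
  apply smul_right_injective _ (qpow_two_sub_one_ne_zero h)
  simp only [smul_smul, ← casVal_sub_eq, sub_smul, ← hC]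
  abel

/-- In characteristic zero the trace of an idempotent is its rank. -/
lemma Matrix.eq_zero_of_idempotent_of_trace_eq_zero {m : Type*} [Fintype m] [DecidableEq m]
    {M : Matrix m m ℂ} (hM : M * M = M) (htr : M.trace = 0) : M = 0 := by
  have h : IsIdempotentElem (Matrix.toLin' M) := by
    rw [IsIdempotentElem, Module.End.mul_eq_comp, ← Matrix.toLin'_mul, hM]
  have h0 := LinearMap.IsIdempotentElem.eq_zero_of_trace_eq_zero h (by simpa using htr)
  simpa using h0

/-- The projector onto the component `V^{K-1/2}` of `V^{1/2} ⊗ V^K` is a linear function of the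
monodromy. -/
lemma RR_sub_eq_smul_projector {θ : ℝ} (h : qdiff θ ≠ 0) {t : ℕ}
    (hne : qpow θ (-(((t + 1 : ℕ) : ℝ) + 2)) - qpow θ ((t + 1 : ℕ) : ℝ) ≠ 0)
    {E : Matrix (Fin (1 + 1) × Fin (t + 1 + 1)) (Fin (t + 1)) ℂ}
    {C : Matrix (Fin (t + 1)) (Fin (1 + 1) × Fin (t + 1 + 1)) ℂ}
    (hE : ∀ ξ, rhoBox θ 1 (t + 1) ξ * E = E * rho θ t ξ)
    (hC : ∀ ξ, C * rhoBox θ 1 (t + 1) ξ = rho θ t ξ * C) (hCE : C * E = 1) :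
    RR θ 1 (t + 1) - qpow θ ((t + 1 : ℕ) : ℝ) • 1 =
      (qpow θ (-(((t + 1 : ℕ) : ℝ) + 2)) - qpow θ ((t + 1 : ℕ) : ℝ)) • (E * C) := by
  have h1 := RR_mul_intertwiner h (hE _)
  have h2 := intertwiner_mul_RR h (hC _)
  have h3 := RR_sq θ (t + 1)
  have h4 := trace_RR θ (t + 1)
  rw [qpow_neg_one_mul_casVal] at h3
  have h5 : qpow θ (-2) =
      qpow θ ((t + 1 : ℕ) : ℝ) * qpow θ (-(((t + 1 : ℕ) : ℝ) + 2)) := by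
    rw [← qpow_add]; congr 1; ring
  rw [h5] at h3
  generalize qpow θ ((t + 1 : ℕ) : ℝ) = ν at *
  generalize qpow θ (-(((t + 1 : ℕ) : ℝ) + 2)) = μ at *
  generalize RR θ 1 (t + 1) = M at *
  have hP : E * C * (E * C) = E * C := by
    rw [Matrix.mul_assoc, ← Matrix.mul_assoc C, hCE, Matrix.one_mul]
  have hMP : M * (E * C) = μ • (E * C) := by rw [← Matrix.mul_assoc, h1, Matrix.smul_mul]
  have hPM : E * C * M = μ • (E * C) := by rw [Matrix.mul_assoc, h2, Matrix.mul_smul]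
  have htr : (E * C).trace = ((t + 1 : ℕ) : ℂ) := by
    rw [Matrix.trace_mul_comm, hCE, Matrix.trace_one, Fintype.card_fin]
  generalize E * C = P at *
  -- Both terms are idempotents of trace `t + 1`. Since `M P = P M = μ P`, the first absorbs `P` on
  -- both sides, so the difference is an idempotent of trace 0.
  have key : (μ - ν)⁻¹ • (M - ν • 1) - P = 0 := by
    apply Matrix.eq_zero_of_idempotent_of_trace_eq_zero
    · have e1 : (M - ν • 1) * (M - ν • 1) = (μ - ν) • (M - ν • 1) := by
        simp only [sub_mul, mul_sub, smul_mul_assoc, mul_smul_comm, one_mul, mul_one, h3]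
        module
      have e2 : (M - ν • 1) * P = (μ - ν) • P := by
        rw [sub_mul, hMP, smul_mul_assoc, one_mul, sub_smul]
      have e3 : P * (M - ν • 1) = (μ - ν) • P := by
        rw [mul_sub, hPM, mul_smul_comm, mul_one, sub_smul]
      generalize M - ν • 1 = N at *
      simp only [sub_mul, mul_sub, smul_mul_assoc, mul_smul_comm, e1, e2, e3, hP, smul_sub,
        smul_smul, inv_mul_cancel₀ hne, one_smul]
      abel
    · rw [Matrix.trace_sub, htr, Matrix.trace_smul, Matrix.trace_sub, h4, Matrix.trace_smul,
        Matrix.trace_one, Fintype.card_prod, Fintype.card_fin, Fintype.card_fin, smul_eq_mul,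
        smul_eq_mul]
      field_simp
      push_cast
      ring
  rw [← sub_eq_zero.mp key, smul_smul, mul_inv_cancel₀ hne, one_smul]

/-! ### Existence of the projector -/

/-- The principal square root is not multiplicative, so signs must be chosen. If `x ≠ 0`, the
product condition fixes `y`; if `x = 0`, then `p = 0` and any root of `u'` works. -/
lemma exists_root_of_mul_eq (x u u' p : ℂ) (hx : x * x = u) (hp : p * p = u * u') :
    ∃ y, y * y = u' ∧ x * y = p := by
  by_cases h : x = 0
  · refine ⟨csqrt u', csqrt_mul_self _, ?_⟩
    have : p * p = 0 := by rw [hp, ← hx, h]; ring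
    rw [h, zero_mul, mul_self_eq_zero.mp this]
  · refine ⟨p / x, ?_, mul_div_cancel₀ _ h⟩
    rw [div_mul_div_comm, hp, hx, mul_div_cancel_left₀]
    rw [← hx]
    exact mul_self_ne_zero.mpr h

/-- Square roots of the `q`-numbers `[t + 1 - i]` and `[i + 1]` whose products are the matrix
entries of the generators on `V^{(t+1)/2}` and `V^{t/2}`. -/
lemma exists_ladder_roots (θ : ℝ) (t : ℕ) :
    ∃ a b : ℕ → ℂ, (∀ i : ℕ, a i * a i = qnum θ ((t : ℝ) + 1 - i)) ∧
      (∀ i : ℕ, b i * b i = qnum θ ((i : ℝ) + 1)) ∧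
      (∀ i, a i * b i = ladder θ (t + 1) i) ∧ ∀ i, b i * a (i + 1) = ladder θ t i := by
  have hb : ∀ (i : ℕ) (x : ℂ), ∃ y, x * x = qnum θ ((t : ℝ) + 1 - i) →
      y * y = qnum θ ((i : ℝ) + 1) ∧ x * y = ladder θ (t + 1) i := by
    intro i x
    by_cases hx : x * x = qnum θ ((t : ℝ) + 1 - i)
    · obtain ⟨y, hy⟩ := exists_root_of_mul_eq x _ (qnum θ ((i : ℝ) + 1)) (ladder θ (t + 1) i) hx
        (by rw [ladder_mul_self]; push_cast; rfl)
      exact ⟨y, fun _ => hy⟩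
    · exact ⟨0, fun h => absurd h hx⟩
  choose f hf using hb
  have ha : ∀ (i : ℕ) (x : ℂ), ∃ y, x * x = qnum θ ((i : ℝ) + 1) →
      y * y = qnum θ ((t : ℝ) + 1 - (i + 1 : ℕ)) ∧ x * y = ladder θ t i := by
    intro i x
    by_cases hx : x * x = qnum θ ((i : ℝ) + 1)
    · obtain ⟨y, hy⟩ := exists_root_of_mul_eq x _ (qnum θ ((t : ℝ) + 1 - (i + 1 : ℕ)))
        (ladder θ t i) hx (by
          rw [ladder_mul_self, mul_comm]; push_cast; congr 2; ring)
      exact ⟨y, fun _ => hy⟩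
    · exact ⟨0, fun h => absurd h hx⟩
  choose g hg using ha
  -- The conditions link the unknowns in one chain `a 0, b 0, a 1, b 1, …`, so each root is chosen
  -- to fit its predecessor, with `b i = f i (a i)` and `a (i + 1) = g i (b i)`.
  let a : ℕ → ℂ := fun i =>
    Nat.rec (csqrt (qnum θ ((t : ℝ) + 1))) (fun i x => g i (f i x)) i
  have h : ∀ i : ℕ, a i * a i = qnum θ ((t : ℝ) + 1 - i) := by
    intro i
    induction i with
    | zero => simpa [a] using csqrt_mul_self _
    | succ i ih => exact (hg i _ (hf i _ ih).1).1
  exact ⟨a, fun i => f i (a i), h, fun i => (hf i _ (h i)).1, fun i => (hf i _ (h i)).2,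
    fun i => (hg i _ (hf i _ (h i)).1).2⟩

/-- The matrix of the map `e_i ↦ α_i e_{1/2} ⊗ e_i + β_i e_{-1/2} ⊗ e_{i+1}`. -/
def embedMat (t : ℕ) (α β : ℕ → ℂ) :
    Matrix (Fin (1 + 1) × Fin (t + 1 + 1)) (Fin (t + 1)) ℂ :=
  Matrix.of fun p i => if p.1 = 1 then (if p.2 = i.castSucc then α i else 0)
    else (if p.2 = i.succ then β i else 0)

section embedMat

variable {t : ℕ} (α β : ℕ → ℂ)

/-- The rows `(0, 0)` and `(1, last)` are separated because the image of `embedMat` has no component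
along these lowest and highest weight vectors of the tensor product. -/
lemma embedMat_ext {M N : Matrix (Fin (1 + 1) × Fin (t + 1 + 1)) (Fin (t + 1)) ℂ}
    (h0 : ∀ i, M (0, 0) i = N (0, 0) i) (hs : ∀ j i, M (0, Fin.succ j) i = N (0, Fin.succ j) i)
    (hc : ∀ j i, M (1, Fin.castSucc j) i = N (1, Fin.castSucc j) i)
    (hl : ∀ i, M (1, Fin.last _) i = N (1, Fin.last _) i) : M = N := by
  ext ⟨s, j⟩ i
  fin_cases s
  · exact Fin.cases (h0 i) (fun j => hs j i) j
  · exact Fin.lastCases (hl i) (fun j => hc j i) j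

lemma blk_mul_embedMat_zero (A B C D : Matrix (Fin (t + 1 + 1)) (Fin (t + 1 + 1)) ℂ) (j) (i) :
    (blk A B C D * embedMat t α β) (0, j) i = A j i.succ * β i + B j i.castSucc * α i := by
  simp [blk, embedMat, Matrix.mul_apply, Fintype.sum_prod_type, Fin.sum_univ_two]

lemma blk_mul_embedMat_one (A B C D : Matrix (Fin (t + 1 + 1)) (Fin (t + 1 + 1)) ℂ) (j) (i) :
    (blk A B C D * embedMat t α β) (1, j) i = C j i.succ * β i + D j i.castSucc * α i := by
  simp [blk, embedMat, Matrix.mul_apply, Fintype.sum_prod_type, Fin.sum_univ_two]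

lemma embedMat_mul_zero_zero (N : Matrix (Fin (t + 1)) (Fin (t + 1)) ℂ) (i) :
    (embedMat t α β * N) (0, 0) i = 0 := by
  simp [embedMat, Matrix.mul_apply, (Fin.succ_ne_zero _).symm]

lemma embedMat_mul_zero_succ (N : Matrix (Fin (t + 1)) (Fin (t + 1)) ℂ) (j i) :
    (embedMat t α β * N) (0, Fin.succ j) i = β j * N j i := by
  simp [embedMat, Matrix.mul_apply]

lemma embedMat_mul_one_castSucc (N : Matrix (Fin (t + 1)) (Fin (t + 1)) ℂ) (j i) :
    (embedMat t α β * N) (1, Fin.castSucc j) i = α j * N j i := by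
  simp [embedMat, Matrix.mul_apply]

lemma embedMat_mul_one_last (N : Matrix (Fin (t + 1)) (Fin (t + 1)) ℂ) (i) :
    (embedMat t α β * N) (1, Fin.last _) i = 0 := by
  simp [embedMat, Matrix.mul_apply, (Fin.castSucc_lt_last _).ne']

lemma embedMat_transpose_mul_self :
    (embedMat t α β)ᵀ * embedMat t α β =
      Matrix.diagonal fun i : Fin (t + 1) => α i * α i + β i * β i := by
  ext i j
  rw [Matrix.mul_apply, Fintype.sum_prod_type, Fin.sum_univ_two]
  by_cases hij : i = j
  · subst hij
    simp [embedMat, add_comm]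
  · simp [embedMat, hij, Ne.symm hij]

end embedMat

lemma qnum_eq_mul_qnum_sub_one {θ : ℝ} (h : qdiff θ ≠ 0) (x : ℝ) :
    qnum θ x = qpow θ 1 * qnum θ (x - 1) + qpow θ (1 - x) := by
  apply mul_left_cancel₀ h
  rw [mul_add, mul_left_comm, qdiff_mul_qnum h, qdiff_mul_qnum h, qdiff, mul_sub, sub_mul]
  simp only [← qpow_add]
  ring_nf

lemma qnum_add_one_eq {θ : ℝ} (h : qdiff θ ≠ 0) (x : ℝ) :
    qnum θ (x + 1) = qpow θ (-1) * qnum θ x + qpow θ x := by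
  apply mul_left_cancel₀ h
  rw [mul_add, mul_left_comm, qdiff_mul_qnum h, qdiff_mul_qnum h, qdiff, mul_sub, sub_mul]
  simp only [← qpow_add]
  ring_nf

lemma qnum_add_eq {θ : ℝ} (h : qdiff θ ≠ 0) (x y : ℝ) :
    qpow θ y * qnum θ x + qpow θ (-x) * qnum θ y = qnum θ (x + y) := by
  apply mul_left_cancel₀ h
  rw [mul_add, mul_left_comm, mul_left_comm (qdiff θ), qdiff_mul_qnum h, qdiff_mul_qnum h,
    qdiff_mul_qnum h, mul_sub, mul_sub]
  simp only [← qpow_add]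
  ring_nf

/-- The Clebsch–Gordan coefficients of the embedding `V^{t/2} → V^{1/2} ⊗ V^{(t+1)/2}`. -/
lemma exists_clebschGordan {θ : ℝ} (h : qdiff θ ≠ 0) (t : ℕ) :
    ∃ α β : ℕ → ℂ,
      (∀ i : ℕ, qpow θ (1 / 2) * ladder θ (t + 1) (i + 1) * β i = β (i + 1) * ladder θ t i) ∧
      (∀ i : ℕ, qpow θ (-(1 / 2)) * ladder θ (t + 1) i * α (i + 1) = α i * ladder θ t i) ∧
      (∀ i : ℕ, qpow θ ((i : ℝ) + 1 - (t + 1) / 2) * β i +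
        qpow θ (-(1 / 2)) * ladder θ (t + 1) i * α i = α (i + 1) * ladder θ t i) ∧
      (∀ i : ℕ, qpow θ (1 / 2) * ladder θ (t + 1) (i + 1) * β (i + 1) +
        qpow θ ((i : ℝ) + 1 - (t + 1) / 2) * α (i + 1) = β i * ladder θ t i) ∧
      qpow θ (1 / 2) * ladder θ (t + 1) 0 * β 0 + qpow θ (-(((t : ℝ) + 1) / 2)) * α 0 = 0 ∧
      ∀ i, α i * α i + β i * β i = qpow θ (-1) * qnum θ ((t : ℝ) + 2) := by
  obtain ⟨a, b, ha, hb, hab, hba⟩ := exists_ladder_roots θ t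
  -- The first and third conditions are compatibility with `X`; the second, fourth and fifth are
  -- compatibility with `Y`, the fifth saying that `Y` kills the lowest weight vector. The minus
  -- sign in `β` produces this cancellation, and the powers of `q` make the normalization in the
  -- last condition independent of `i`.
  refine ⟨fun i => qpow θ (i / 2) * a i, fun i => -(qpow θ ((i - t - 2) / 2) * b i),
    fun i => ?_, fun i => ?_, fun i => ?_, fun i => ?_, ?_, fun i => ?_⟩
  · beta_reduce
    rw [← hab, ← hba]
    have e : qpow θ ((((i + 1 : ℕ) : ℝ) - t - 2) / 2) =
        qpow θ (1 / 2) * qpow θ (((i : ℝ) - t - 2) / 2) := by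
      rw [← qpow_add]; push_cast; congr 1; ring
    rw [e]; ring
  · beta_reduce
    rw [← hab, ← hba]
    have e : qpow θ ((i : ℝ) / 2) = qpow θ (-(1 / 2)) * qpow θ (((i + 1 : ℕ) : ℝ) / 2) := by
      rw [← qpow_add]; push_cast; congr 1; ring
    rw [e]; ring
  · beta_reduce
    rw [← hab, ← hba]
    have e1 := ha i
    have e2 := ha (i + 1)
    have e3 := qnum_eq_mul_qnum_sub_one h ((t : ℝ) + 1 - i)
    rw [show (t : ℝ) + 1 - i - 1 = t + 1 - (i + 1 : ℕ) by push_cast; ring] at e3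
    have e4 : qpow θ ((i : ℝ) + 1 - (t + 1) / 2) * qpow θ (((i : ℝ) - t - 2) / 2) =
        qpow θ (-(1 / 2)) * qpow θ ((i : ℝ) / 2) * qpow θ (1 - ((t : ℝ) + 1 - i)) := by
      simp only [← qpow_add]; congr 1; ring
    have e5 : qpow θ (((i + 1 : ℕ) : ℝ) / 2) =
        qpow θ (-(1 / 2)) * qpow θ ((i : ℝ) / 2) * qpow θ 1 := by
      simp only [← qpow_add]; push_cast; congr 1; ring
    rw [e5]
    linear_combination (-b i) * e4 + qpow θ (-(1 / 2)) * qpow θ ((i : ℝ) / 2) * b i *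
      (e1 + e3 - qpow θ 1 * e2)
  · beta_reduce
    rw [← hab, ← hba]
    have e1 := hb i
    have e2 := hb (i + 1)
    have e3 := qnum_add_one_eq h ((i : ℝ) + 1)
    rw [show (i : ℝ) + 1 + 1 = (i + 1 : ℕ) + 1 by push_cast; ring] at e3
    have e4 : qpow θ ((i : ℝ) + 1 - (t + 1) / 2) * qpow θ (((i + 1 : ℕ) : ℝ) / 2) =
        qpow θ (1 / 2) * qpow θ ((((i + 1 : ℕ) : ℝ) - t - 2) / 2) * qpow θ ((i : ℝ) + 1) := by
      simp only [← qpow_add]; push_cast; congr 1; ring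
    have e5 : qpow θ (((i : ℝ) - t - 2) / 2) =
        qpow θ (1 / 2) * qpow θ ((((i + 1 : ℕ) : ℝ) - t - 2) / 2) * qpow θ (-1) := by
      simp only [← qpow_add]; push_cast; congr 1; ring
    rw [e5]
    linear_combination a (i + 1) * e4 -
      qpow θ (1 / 2) * qpow θ ((((i + 1 : ℕ) : ℝ) - t - 2) / 2) * a (i + 1) *
        (e2 + e3 - qpow θ (-1) * e1)
  · beta_reduce
    rw [← hab]
    have e1 := hb 0
    rw [Nat.cast_zero, zero_add, qnum_one h] at e1
    have e4 : qpow θ (-(((t : ℝ) + 1) / 2)) * qpow θ (((0 : ℕ) : ℝ) / 2) =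
        qpow θ (1 / 2) * qpow θ ((((0 : ℕ) : ℝ) - t - 2) / 2) := by
      simp only [← qpow_add]; push_cast; congr 1; ring
    linear_combination a 0 * e4 - qpow θ (1 / 2) * qpow θ ((((0 : ℕ) : ℝ) - t - 2) / 2) * a 0 * e1
  · have e1 := ha i
    have e2 := hb i
    have e3 := qnum_add_eq h ((t : ℝ) + 1 - i) ((i : ℝ) + 1)
    rw [show (t : ℝ) + 1 - i + (i + 1) = t + 2 by ring] at e3
    have e4 : qpow θ ((i : ℝ) / 2) * qpow θ ((i : ℝ) / 2) =
        qpow θ (-1) * qpow θ ((i : ℝ) + 1) := by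
      simp only [← qpow_add]; congr 1; ring
    have e5 : qpow θ (((i : ℝ) - t - 2) / 2) * qpow θ (((i : ℝ) - t - 2) / 2) =
        qpow θ (-1) * qpow θ (-((t : ℝ) + 1 - i)) := by
      simp only [← qpow_add]; congr 1; ring
    rw [← e1, ← e2] at e3
    linear_combination a i * a i * e4 + b i * b i * e5 + qpow θ (-1) * e3

lemma intertwines_of_generators {θ : ℝ} {m p : Type} [Fintype m] [DecidableEq m] [Fintype p]
    [DecidableEq p] (f : Uq θ →ₐ[ℂ] Matrix m m ℂ) (g : Uq θ →ₐ[ℂ] Matrix p p ℂ)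
    (E : Matrix m p ℂ) (h : ∀ x, f (uq θ x) * E = E * g (uq θ x)) (ξ : Uq θ) :
    f ξ * E = E * g ξ := by
  obtain ⟨x, rfl⟩ := RingQuot.mkAlgHom_surjective ℂ (UqRel θ) ξ
  induction x using FreeAlgebra.induction with
  | grade0 c =>
    simp only [AlgHom.commutes, Matrix.algebraMap_eq_diagonal]
    ext i j
    simp [mul_comm]
  | grade1 x => exact h x
  | mul a b ha hb =>
    rw [map_mul, map_mul, map_mul, Matrix.mul_assoc, hb, ← Matrix.mul_assoc, ha, Matrix.mul_assoc]
  | add a b ha hb => simp only [map_add, Matrix.add_mul, Matrix.mul_add, ha, hb]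

/-- The second conjunct makes a multiple of `Eᵀ` a left inverse of `E` as soon as `[t + 2] ≠ 0`. -/
lemma exists_intertwiner {θ : ℝ} (h : qdiff θ ≠ 0) (t : ℕ) :
    ∃ E : Matrix (Fin (1 + 1) × Fin (t + 1 + 1)) (Fin (t + 1)) ℂ,
      (∀ g, rhoBox θ 1 (t + 1) (uq θ g) * E = E * rho θ t (uq θ g)) ∧
      Eᵀ * E = (qpow θ (-1) * qnum θ ((t : ℝ) + 2)) • 1 := by
  obtain ⟨α, β, h1, h2, h3, h4, h5, h6⟩ := exists_clebschGordan h t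
  refine ⟨embedMat t α β, fun g => ?_, ?_⟩
  · cases g
    · rw [rhoBox_one_k, rho_uq]
      apply embedMat_ext <;> intros <;>
        simp only [blk_mul_embedMat_zero, blk_mul_embedMat_one, embedMat_mul_zero_zero,
          embedMat_mul_zero_succ, embedMat_mul_one_castSucc, embedMat_mul_one_last, rhoGen,
          Matrix.smul_apply, Matrix.diagonal_apply, Matrix.zero_apply, zero_mul, add_zero, zero_add,
          smul_eq_mul, Fin.succ_inj, Fin.castSucc_inj]
      · rw [if_neg (Fin.succ_ne_zero _).symm]; ring
      · split_ifs with hij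
        · subst hij
          rw [← qpow_add, mul_comm (β _)]
          congr 2
          simp [wt]; ring
        · ring
      · split_ifs with hij
        · subst hij
          rw [← qpow_add, mul_comm (α _)]
          congr 2
          simp [wt]; ring
        · ring
      · rw [if_neg (Fin.castSucc_lt_last _).ne']; ring
    · rw [rhoBox_one_kinv, rho_uq]
      apply embedMat_ext <;> intros <;>
        simp only [blk_mul_embedMat_zero, blk_mul_embedMat_one, embedMat_mul_zero_zero,
          embedMat_mul_zero_succ, embedMat_mul_one_castSucc, embedMat_mul_one_last, rhoGen,
          Matrix.smul_apply, Matrix.diagonal_apply, Matrix.zero_apply, zero_mul, add_zero, zero_add,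
          smul_eq_mul, Fin.succ_inj, Fin.castSucc_inj]
      · rw [if_neg (Fin.succ_ne_zero _).symm]; ring
      · split_ifs with hij
        · subst hij
          rw [← qpow_add, mul_comm (β _)]
          congr 2
          simp [wt]; ring
        · ring
      · split_ifs with hij
        · subst hij
          rw [← qpow_add, mul_comm (α _)]
          congr 2
          simp [wt]; ring
        · ring
      · rw [if_neg (Fin.castSucc_lt_last _).ne']; ring
    · rw [rhoBox_one_X h, rho_uq]
      have hk : ∀ (i : Fin (t + 1)) (j : Fin (t + 1 + 1)), rhoGen θ (t + 1) .k j i.succ =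
          if (j : ℕ) = i + 1 then qpow θ ((i : ℝ) + 1 - (t + 1) / 2) else 0 := by
        intro i j
        simp only [rhoGen, Matrix.diagonal_apply, Fin.ext_iff, Fin.val_succ, wt]
        split_ifs with hij
        · rw [hij]; push_cast; rfl
        · rfl
      apply embedMat_ext <;> intros <;>
        simp only [blk_mul_embedMat_zero, blk_mul_embedMat_one, embedMat_mul_zero_zero,
          embedMat_mul_zero_succ, embedMat_mul_one_castSucc, embedMat_mul_one_last, hk,
          rhoGen_X_apply, Matrix.smul_apply, Matrix.zero_apply, zero_mul, add_zero,
          smul_eq_mul, Fin.val_succ, Fin.val_castSucc, Fin.val_last,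
          add_left_inj]
      · simp
      · split_ifs with hij
        · rw [hij]; exact h1 _
        · ring
      · split_ifs with hij
        · rw [hij]; exact h3 _
        · ring
      · split_ifs with hij
        -- The case `i = t`: the image of the highest weight vector must be killed by `X`, and it is
        -- because the ladder coefficient of `V^{t/2}` vanishes at its top.
        · rw [h3, ← hij, ladder_self, mul_zero]
        · ring
    · rw [rhoBox_one_Y h, rho_uq]
      have hk : ∀ (i : Fin (t + 1)) (j : Fin (t + 1 + 1)), rhoGen θ (t + 1) .k j i.castSucc =
          if (j : ℕ) = i then qpow θ ((i : ℝ) - (t + 1) / 2) else 0 := by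
        intro i j
        simp only [rhoGen, Matrix.diagonal_apply, Fin.ext_iff, Fin.val_castSucc, wt]
        split_ifs with hij
        · rw [hij]; push_cast; rfl
        · rfl
      apply embedMat_ext <;> intros <;>
        simp only [blk_mul_embedMat_zero, blk_mul_embedMat_one, embedMat_mul_zero_zero,
          embedMat_mul_zero_succ, embedMat_mul_one_castSucc, embedMat_mul_one_last, hk,
          rhoGen_Y_apply, Matrix.smul_apply, Matrix.zero_apply, zero_mul, zero_add,
          smul_eq_mul, Fin.val_succ, Fin.val_castSucc, Fin.val_last,
          add_left_inj]
      · rename_i i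
        by_cases hi : i = 0
        · subst hi
          simpa using h5
        · have hi' : (0 : ℕ) ≠ i := fun h0 => hi (Fin.ext h0.symm)
          simp [hi, hi']
      · rename_i j i
        by_cases hi : (i : ℕ) = j + 1
        · rw [if_pos hi, if_pos hi.symm, if_pos hi, hi]
          push_cast
          exact h4 _
        · rw [if_neg hi, if_neg (Ne.symm hi), if_neg hi]; ring
      · split_ifs with hij
        · rw [hij]; exact h2 _
        · ring
      · rw [if_neg (by omega)]; ring
  · rw [embedMat_transpose_mul_self]
    simp only [h6]
    rw [Matrix.smul_one_eq_diagonal]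

/-- The other component `c = t + 2` is cut off by `1 + (t + 1) + c ≤ 2 (t + 1)`. -/
lemma admissible_one_self (t : ℕ) : admissible (t + 1) 1 (t + 1) = {t} := by
  ext c
  simp only [admissible, Finset.mem_filter, Finset.mem_range, Finset.mem_singleton, Nat.even_iff]
  omega

/-- Transposition exchanges `X` and `Y` in the single and in the tensor product representations, so
`Eᵀ` intertwines in the opposite direction and `C` can be taken as a multiple of `Eᵀ`. -/
lemma exists_isTruncation {θ : ℝ} (h : qdiff θ ≠ 0) (t : ℕ) (hq : qnum θ ((t : ℝ) + 2) ≠ 0) :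
    ∃ P, IsTruncation θ (t + 1) 1 (t + 1) P := by
  obtain ⟨E, hE, hEE⟩ := exists_intertwiner h t
  have hk : (rhoBox θ 1 (t + 1) (uq θ .k))ᵀ = rhoBox θ 1 (t + 1) (uq θ .k) := by
    rw [rhoBox_k, ← Matrix.kroneckerMap_transpose, rhoGen_k_transpose, rhoGen_k_transpose]
  have hkinv : (rhoBox θ 1 (t + 1) (uq θ .kinv))ᵀ = rhoBox θ 1 (t + 1) (uq θ .kinv) := by
    rw [rhoBox_kinv, ← Matrix.kroneckerMap_transpose, rhoGen_kinv_transpose,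
      rhoGen_kinv_transpose]
  have hX : (rhoBox θ 1 (t + 1) (uq θ .X))ᵀ = rhoBox θ 1 (t + 1) (uq θ .Y) := by
    rw [rhoBox_X, rhoBox_Y, Matrix.transpose_add, ← Matrix.kroneckerMap_transpose,
      ← Matrix.kroneckerMap_transpose, rhoGen_k_transpose, rhoGen_kinv_transpose,
      rhoGen_X_transpose, rhoGen_X_transpose]
  have hY : (rhoBox θ 1 (t + 1) (uq θ .Y))ᵀ = rhoBox θ 1 (t + 1) (uq θ .X) := by
    rw [← hX, Matrix.transpose_transpose]
  have hET : ∀ g, rho θ t (uq θ g) * Eᵀ = Eᵀ * rhoBox θ 1 (t + 1) (uq θ g) := by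
    intro g
    apply Matrix.transpose_injective
    rw [Matrix.transpose_mul, Matrix.transpose_mul, Matrix.transpose_transpose, rho_uq]
    cases g
    · rw [hk, rhoGen_k_transpose, hE, rho_uq]
    · rw [hkinv, rhoGen_kinv_transpose, hE, rho_uq]
    · rw [hX, rhoGen_X_transpose, hE, rho_uq]
    · rw [hY, rhoGen_Y_transpose, hE, rho_uq]
  have hE' := intertwines_of_generators _ _ E hE
  have hET' := intertwines_of_generators _ _ Eᵀ hET
  have hc : qpow θ (-1) * qnum θ ((t : ℝ) + 2) ≠ 0 := mul_ne_zero (qpow_ne_zero _ _) hq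
  generalize qpow θ (-1) * qnum θ ((t : ℝ) + 2) = c at *
  refine ⟨_, Or.inr ⟨by omega, Function.update (fun _ => 0) t E,
    Function.update (fun _ => 0) t (c⁻¹ • Eᵀ), ?_, ?_, ?_, rfl⟩⟩
  · intro d hd ξ
    rw [admissible_one_self, Finset.mem_singleton] at hd
    subst hd
    simp only [Function.update_self]
    exact ⟨hE' ξ, by rw [Matrix.smul_mul, Matrix.mul_smul, hET' ξ]⟩
  · intro d hd
    rw [admissible_one_self, Finset.mem_singleton] at hd
    subst hd
    simp only [Function.update_self]
    rw [Matrix.smul_mul, hEE, smul_smul, inv_mul_cancel₀ hc, one_smul]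
  · intro d hd d' hd' hne
    rw [admissible_one_self, Finset.mem_singleton] at hd hd'
    exact absurd (hd.trans hd'.symm) hne

/-! ### The partial quantum trace after truncation -/

lemma qtrLeft_sub (θ : ℝ) (a n : ℕ)
    (Z W : Matrix (Fin (a + 1) × Fin (n + 1)) (Fin (a + 1) × Fin (n + 1)) ℂ) :
    qtrLeft θ a n (Z - W) = qtrLeft θ a n Z - qtrLeft θ a n W := by
  ext i j
  simp only [qtrLeft, qtr, Matrix.of_apply, Matrix.sub_apply, ← Matrix.trace_sub,
    ← Matrix.sub_mul]
  rfl

/-- At the top spin `K = k / 2`, with `q ^ (k + 2) = 1`, the truncation does not change the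
partial quantum trace of the monodromy. -/
lemma qtrLeft_RR_mul_of_isTruncation_top {θ : ℝ} (h : qdiff θ ≠ 0) (t : ℕ)
    (hroot : qpow θ (((t + 1 : ℕ) : ℝ) + 2) = 1) {P} (hP : IsTruncation θ (t + 1) 1 (t + 1) P) :
    qtrLeft θ 1 (t + 1) (RR θ 1 (t + 1) * P) = casVal θ (t + 1) • 1 := by
  rcases hP with ⟨hle, -⟩ | ⟨-, E, C, hEC, hCE, -, rfl⟩
  · omega
  · rw [admissible_one_self] at hEC hCE ⊢
    rw [Finset.sum_singleton]
    have hE := fun ξ => (hEC t (Finset.mem_singleton_self t) ξ).1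
    have hC := fun ξ => (hEC t (Finset.mem_singleton_self t) ξ).2
    have hCE := hCE t (Finset.mem_singleton_self t)
    have hμ : qpow θ (-(((t + 1 : ℕ) : ℝ) + 2)) = 1 := by rw [qpow_neg, hroot, inv_one]
    have hν : qpow θ ((t + 1 : ℕ) : ℝ) * qpow θ 2 = 1 := by rw [← qpow_add, hroot]
    have hne : 1 - qpow θ ((t + 1 : ℕ) : ℝ) ≠ 0 := by
      intro h0
      rw [← sub_eq_zero.mp h0, one_mul] at hν
      exact qpow_two_sub_one_ne_zero h (sub_eq_zero.mpr hν)
    have hproj := RR_sub_eq_smul_projector h (by rwa [hμ]) hE hC hCE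
    rw [← Matrix.mul_assoc, RR_mul_intertwiner h (hE _), hμ, one_smul]
    rw [hμ] at hproj
    have hz : casVal θ (t + 1) = qpow θ 1 + qpow θ (-1) := by
      have e : qpow θ (((t + 1 : ℕ) : ℝ) + 1) = qpow θ (-1) := by
        rw [show ((t + 1 : ℕ) : ℝ) + 1 = ((t + 1 : ℕ) : ℝ) + 2 + -1 by ring, qpow_add, hroot,
          one_mul]
      rw [casVal, qpow_neg _ (((t + 1 : ℕ) : ℝ) + 1), e, ← qpow_neg, neg_neg, add_comm]
    -- Here `casVal` equals `q + q⁻¹`, which is also the partial quantum trace of the identity. With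
    -- `ν = q^n` and eigenvalue 1, the projector identity becomes `(1 - ν) casVal = (1 - ν) tr_q(E
    -- C)`, and `1 - ν` cancels.
    have htr := congrArg (qtrLeft θ 1 (t + 1)) hproj
    rw [qtrLeft_sub, qtrLeft_RR, qtrLeft_smul, qtrLeft_smul, blk_one, qtrLeft_blk, ← add_smul,
      ← hz, smul_smul, ← sub_smul] at htr
    apply smul_right_injective _ hne
    simp only
    rw [← htr, smul_smul]
    congr 1
    ring

/-! ### The area spectrum -/

/-- The operator is scalar, so its spectrum is one point, and `ψ` is the only angle in `[0, π]` with
the same cosine as `φ`. -/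
lemma areaSpec_smul_one {Λ : ℝ} (hΛ : Λ ≠ 0) {n : ℕ} {φ ψ : ℝ} (hψ : ψ ∈ Set.Icc 0 Real.pi)
    (hcos : Real.cos ψ = Real.cos φ) :
    areaSpec Λ (((2 * Real.cos φ : ℝ) : ℂ) • (1 : Matrix (Fin (n + 1)) (Fin (n + 1)) ℂ)) =
      {6 / |Λ| * ψ} := by
  have hpos : 0 < |Λ| := abs_pos.mpr hΛ
  have hsp : spectrum ℂ ((1 / 2 : ℂ) • (((2 * Real.cos φ : ℝ) : ℂ) •
      (1 : Matrix (Fin (n + 1)) (Fin (n + 1)) ℂ))) = {((Real.cos φ : ℝ) : ℂ)} := by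
    rw [smul_smul, show (1 / 2 : ℂ) * ((2 * Real.cos φ : ℝ) : ℂ) = ((Real.cos φ : ℝ) : ℂ) by
      push_cast; ring, ← Algebra.algebraMap_eq_smul_one, spectrum.scalar_eq]
  ext x
  rw [areaSpec, Set.mem_ofPred_eq, hsp, Set.mem_singleton_iff, Set.mem_singleton_iff,
    Complex.ofReal_inj, ← hcos]
  constructor
  · rintro ⟨hx, hc⟩
    rw [← Real.injOn_cos hx hψ hc]
    field_simp
  · rintro rfl
    have : |Λ| / 6 * (6 / |Λ| * ψ) = ψ := by field_simp
    rw [this]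
    exact ⟨hψ, rfl⟩

lemma areaSpec_smul_one_of_le {Λ : ℝ} (hΛ : Λ ≠ 0) {n : ℕ} {φ : ℝ} (h0 : 0 ≤ φ)
    (h1 : φ ≤ Real.pi) :
    areaSpec Λ (((2 * Real.cos φ : ℝ) : ℂ) • (1 : Matrix (Fin (n + 1)) (Fin (n + 1)) ℂ)) =
      {6 / |Λ| * φ} :=
  areaSpec_smul_one hΛ ⟨h0, h1⟩ rfl

lemma areaSpec_smul_one_of_ge {Λ : ℝ} (hΛ : Λ ≠ 0) {n : ℕ} {φ : ℝ} (h0 : Real.pi ≤ φ)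
    (h1 : φ ≤ 2 * Real.pi) :
    areaSpec Λ (((2 * Real.cos φ : ℝ) : ℂ) • (1 : Matrix (Fin (n + 1)) (Fin (n + 1)) ℂ)) =
      {6 / |Λ| * (2 * Real.pi - φ)} :=
  areaSpec_smul_one hΛ ⟨by linarith, by linarith⟩ (Real.cos_two_pi_sub φ)

lemma centralRep_one_left (θ : ℝ) (n : ℕ) :
    centralRep θ 1 n = ((2 * Real.cos (((n : ℝ) + 1) * θ) : ℝ) : ℂ) • 1 := by
  rw [centralRep_eq_qtrLeft, qtrLeft_RR, casVal_eq_cos]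

lemma qdiff_ne_zero_of_lt_pi {θ : ℝ} (h0 : 0 < θ) (h1 : θ < Real.pi) : qdiff θ ≠ 0 := by
  rw [qdiff, qpow_sub_qpow_neg, one_mul]
  have := (Real.sin_pos_of_pos_of_lt_pi h0 h1).ne'
  exact mul_ne_zero (mul_ne_zero two_ne_zero Complex.I_ne_zero) (Complex.ofReal_ne_zero.mpr this)

/-! ### The root of unity `q = exp(2πi/(k+2))` -/

section rootOfUnity

variable {k : ℕ}

lemma two_pi_div_lt_pi (hk : 1 ≤ k) : 2 * Real.pi / ((k : ℝ) + 2) < Real.pi := by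
  have h1 : (1 : ℝ) ≤ k := by exact_mod_cast hk
  rw [div_lt_iff₀ (by positivity)]
  nlinarith [Real.pi_pos]

lemma qdiff_root_ne_zero (hk : 1 ≤ k) : qdiff (2 * Real.pi / ((k : ℝ) + 2)) ≠ 0 :=
  qdiff_ne_zero_of_lt_pi (by positivity) (two_pi_div_lt_pi hk)

lemma qpow_root (k : ℕ) : qpow (2 * Real.pi / ((k : ℝ) + 2)) ((k : ℝ) + 2) = 1 := by
  rw [qpow, div_mul_cancel₀ _ (by positivity), mul_comm]
  push_cast
  exact Complex.exp_two_pi_mul_I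

/-- From `q^{k+2} = 1` one has `q^{k+1} = q⁻¹`, so a vanishing `[k+1]` would force `q = q⁻¹`. -/
lemma qnum_root_ne_zero (hk : 1 ≤ k) :
    qnum (2 * Real.pi / ((k : ℝ) + 2)) ((k : ℝ) + 1) ≠ 0 := by
  have h := qdiff_root_ne_zero hk
  have e : qpow (2 * Real.pi / ((k : ℝ) + 2)) ((k : ℝ) + 1) =
      qpow (2 * Real.pi / ((k : ℝ) + 2)) (-1) := by
    rw [show (k : ℝ) + 1 = k + 2 + -1 by ring, qpow_add, qpow_root, one_mul]
  intro h0
  have := qdiff_mul_qnum h ((k : ℝ) + 1)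
  rw [h0, mul_zero, qpow_neg _ ((k : ℝ) + 1), e, ← qpow_neg, neg_neg] at this
  exact h (by rw [qdiff]; linear_combination this)

lemma exists_isTruncation_root {n : ℕ} (hk : 1 ≤ k) (hn : n ≤ k) :
    ∃ P, IsTruncation (2 * Real.pi / ((k : ℝ) + 2)) k 1 n P := by
  by_cases hle : 1 + n ≤ k
  · exact ⟨1, Or.inl ⟨hle, rfl⟩⟩
  · obtain rfl : n = k := by omega
    obtain ⟨t, rfl⟩ : ∃ t, n = t + 1 := ⟨n - 1, by omega⟩
    apply exists_isTruncation (qdiff_root_ne_zero hk)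
    have := qnum_root_ne_zero hk
    rwa [show ((t + 1 : ℕ) : ℝ) + 1 = t + 2 by push_cast; ring] at this

lemma qtrLeft_RR_mul_of_isTruncation {n : ℕ} (hk : 1 ≤ k) (hn : n ≤ k) {P}
    (hP : IsTruncation (2 * Real.pi / ((k : ℝ) + 2)) k 1 n P) :
    qtrLeft (2 * Real.pi / ((k : ℝ) + 2)) 1 n (RR (2 * Real.pi / ((k : ℝ) + 2)) 1 n * P) =
      casVal (2 * Real.pi / ((k : ℝ) + 2)) n • 1 := by
  by_cases hle : 1 + n ≤ k
  · rcases hP with ⟨-, rfl⟩ | ⟨hlt, -⟩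
    · rw [mul_one, qtrLeft_RR]
    · omega
  · obtain rfl : n = k := by omega
    obtain ⟨t, rfl⟩ : ∃ t, n = t + 1 := ⟨n - 1, by omega⟩
    exact qtrLeft_RR_mul_of_isTruncation_top (qdiff_root_ne_zero hk) t (qpow_root _) hP

end rootOfUnity

end

theorem mainTheorem2 (Λ : ℝ) (hΛ : Λ ≠ 0) :
    -- `q = exp (i θ)` and spin `K = n / 2`
    (∀ θ : ℝ, 0 < θ → θ < 2 * Real.pi → ∀ n : ℕ, ∀ K : ℝ, K = n / 2 →
      centralRep θ 1 n = ((2 * Real.cos ((2 * K + 1) * θ) : ℝ) : ℂ) • 1 ∧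
      (qnum θ (2 * K + 1) ≠ 0 →
        qdim θ n = qnum θ (2 * K + 1) ∧
        sMat θ 1 n = qnum θ (2 * (2 * K + 1)) ∧
        centralRep θ 1 n = (qnum θ (2 * (2 * K + 1)) / qnum θ (2 * K + 1)) • 1) ∧
      (K < 1 / 2 * (Real.pi / θ - 1) →
        areaSpec Λ (centralRep θ 1 n) = {6 / |Λ| * ((2 * K + 1) * θ)}) ∧
      (1 / 2 * (Real.pi / θ - 1) ≤ K → K < 1 / 2 * (2 * Real.pi / θ - 1) →
        areaSpec Λ (centralRep θ 1 n) = {6 / |Λ| * (2 * Real.pi - (2 * K + 1) * θ)})) ∧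
    -- `q = exp (2 π i / (k + 2))` and spin `K = n / 2 ≤ k / 2`, without and with truncation
    (∀ k n : ℕ, ∀ θ K : ℝ, θ = 2 * Real.pi / (k + 2) → K = n / 2 → K ≤ k / 2 →
      (K < k / 4 →
        areaSpec Λ (centralRep θ 1 n) =
          {6 / |Λ| * ((2 * K + 1) * (2 * Real.pi / (k + 2)))}) ∧
      ((k : ℝ) / 4 ≤ K →
        areaSpec Λ (centralRep θ 1 n) =
          {6 / |Λ| * (2 * Real.pi - (2 * K + 1) * (2 * Real.pi / (k + 2)))}) ∧
      (1 ≤ k →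
        (∃ P, IsTruncation θ k 1 n P) ∧
        ∀ P, IsTruncation θ k 1 n P →
          centralRepTrunc θ 1 n P = ((2 * Real.cos ((2 * K + 1) * θ) : ℝ) : ℂ) • 1 ∧
          sMatTrunc θ 1 n P = qnum θ (2 * (2 * K + 1)) ∧
          (K < k / 4 →
            areaSpec Λ (centralRepTrunc θ 1 n P) =
              {6 / |Λ| * ((2 * K + 1) * (2 * Real.pi / (k + 2)))}) ∧
          ((k : ℝ) / 4 ≤ K →
            areaSpec Λ (centralRepTrunc θ 1 n P) =
              {6 / |Λ| * (2 * Real.pi - (2 * K + 1) * (2 * Real.pi / (k + 2)))}))) := by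
  constructor
  · rintro θ h0 - n K rfl
    rw [show 2 * ((n : ℝ) / 2) + 1 = n + 1 by ring]
    have hcen := centralRep_one_left θ n
    refine ⟨hcen, fun hq => ?_, fun hK => ?_, fun hK hK' => ?_⟩
    -- By the convention for zero denominators every `q`-number is 0 at `q = -1`, so `hq` excludes
    -- this point.
    · have h : qdiff θ ≠ 0 := fun h => hq (qnum_eq_zero h _)
      refine ⟨qdim_eq_qnum h n, ?_, ?_⟩
      · rw [sMat_one_left, qdim_eq_qnum h, qnum_two_mul, casVal]
      · rw [centralRep_eq_qtrLeft, qtrLeft_RR, qnum_two_mul, mul_div_cancel_right₀ _ hq, casVal]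
    · rw [hcen]
      have : (n : ℝ) + 1 < Real.pi / θ := by linarith
      rw [lt_div_iff₀ h0] at this
      exact areaSpec_smul_one_of_le hΛ (by positivity) this.le
    · rw [hcen]
      have h1 : Real.pi / θ ≤ (n : ℝ) + 1 := by linarith
      have h2 : (n : ℝ) + 1 < 2 * Real.pi / θ := by linarith
      rw [div_le_iff₀ h0] at h1
      rw [lt_div_iff₀ h0] at h2
      exact areaSpec_smul_one_of_ge hΛ h1 h2.le
  · rintro k n θ K rfl rfl hK
    rw [show 2 * ((n : ℝ) / 2) + 1 = n + 1 by ring]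
    have hn : n ≤ k := by
      have : (n : ℝ) ≤ k := by linarith
      exact_mod_cast this
    have hcen := centralRep_one_left (2 * Real.pi / ((k : ℝ) + 2)) n
    have hk2 : (0 : ℝ) < k + 2 := by positivity
    have hlow : (n : ℝ) / 2 < k / 4 →
        ((n : ℝ) + 1) * (2 * Real.pi / (k + 2)) ≤ Real.pi := by
      intro h
      rw [mul_div_assoc', div_le_iff₀ hk2]
      nlinarith [Real.pi_pos]
    have hhigh : (k : ℝ) / 4 ≤ (n : ℝ) / 2 →
        Real.pi ≤ ((n : ℝ) + 1) * (2 * Real.pi / (k + 2)) := by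
      intro h
      rw [mul_div_assoc', le_div_iff₀ hk2]
      nlinarith [Real.pi_pos]
    have htop : ((n : ℝ) + 1) * (2 * Real.pi / (k + 2)) ≤ 2 * Real.pi := by
      rw [mul_div_assoc', div_le_iff₀ hk2]
      nlinarith [Real.pi_pos]
    refine ⟨fun h => ?_, fun h => ?_, fun hk => ⟨exists_isTruncation_root hk hn, fun P hP => ?_⟩⟩
    · rw [hcen]
      exact areaSpec_smul_one_of_le hΛ (by positivity) (hlow h)
    · rw [hcen]
      exact areaSpec_smul_one_of_ge hΛ (hhigh h) htop
    · have hq := qtrLeft_RR_mul_of_isTruncation hk hn hP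
      have hcen' : centralRepTrunc (2 * Real.pi / ((k : ℝ) + 2)) 1 n P =
          ((2 * Real.cos (((n : ℝ) + 1) * (2 * Real.pi / (k + 2))) : ℝ) : ℂ) • 1 := by
        rw [centralRepTrunc_eq_qtrLeft, hq, casVal_eq_cos]
      refine ⟨hcen', ?_, fun h => ?_, fun h => ?_⟩
      · rw [sMatTrunc, hq, qtr_smul_one, qdim_eq_qnum (qdiff_root_ne_zero hk), qnum_two_mul, casVal]
      · rw [hcen']
        exact areaSpec_smul_one_of_le hΛ (by positivity) (hlow h)
      · rw [hcen']
        exact areaSpec_smul_one_of_ge hΛ (hhigh h) htop
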